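/- Let $Q$ be a Dynkin quiver of type $A_n$ ($n\ge 1$), $D_n$ ($n\ge 4$), $E_6$, $E_7$ or $E_8$, that is, a quiver whose underlying unoriented graph is the Dynkin diagram of that type. Label its vertices by $1,\dots,n$ so that the diagram is: the chain $1-2-\cdots-n$ in type $A_n$; the chain $1-2-\cdots-(n-1)$ together with the edge $(n-2)-n$ in type $D_n$; the chain $1-2-\cdots-(n-1)$ together with the edge $(n-3)-n$ in type $E_n$, $n=6,7,8$. In the standard orientation every edge is oriented from the smaller label to the larger one. The repetition quiver $\mathbb{Z}Q$ has the vertices $(m,i)$ with $m\in\mathbb{Z}$, $i\in Q_0$, and for every arrow $i\to j$ of $Q$ and every $m$ the arrows $(m,i)\to(m,j)$ and $(m,j)\to(m+1,i)$. Put $\tau(m,i)=(m-1,i)$. A function $f$ on the vertices of $\mathbb{Z}Q$ with values in a commutative ring is an additive frieze if $f(\tau v)+f(v)=\sum_{w\to v}f(w)$ for all $v$, and a multiplicative frieze if $f(\tau v)f(v)=1+\prod_{w\to v}f(w)$ for all $v$, where the sum and the product run over all arrows of $\mathbb{Z}Q$ that end at $v$. The generic additive frieze $f_{ad}:\mathbb{Z}Q\to\mathbb{Z}[x_1,\dots,x_n]$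 and the generic multiplicative frieze $f_{mu}:\mathbb{Z}Q\to\mathbb{Q}(x_1,\dots,x_n)$ are the additive and the multiplicative frieze with the value $x_i$ at $(0,i)$ for $1\le i\le n$. For the standard orientation the Nakayama permutation $\nu$ of the vertices of $\mathbb{Z}Q$ is given by - $\nu(m,i)=(m+i-1,\,n+1-i)$ in type $A_n$; - $\nu(m,i)=(m+n-2,\,i)$ in type $D_n$ with $n$ even; - $\nu(m,i)=(m+n-2,\,i)$ for $1\le i\le n-2$, $\nu(m,n-1)=(m+n-2,\,n)$ and $\nu(m,n)=(m+n-2,\,n-1)$ in type $D_n$ with $n$ odd; - $\nu(m,i)=(m+i+2,\,6-i)$ for $1\le i\le 5$ and $\nu(m,6)=(m+5,\,6)$ in type $E_6$; - $\nu(m,i)=(m+8,\,i)$ in type $E_7$; - $\nu(m,i)=(m+14,\,i)$ in type $E_8$. For any other orientation $Q$ of the same diagram, $\nu$ is transported along the isomorphism $(m,i)\mapsto(m-r_i,i)$ from $\mathbb{Z}Q$ to the repetition quiver of the standard orientation, where $r_i$ is the number of edges on the path from $1$ to $i$ in the diagram that $Q$ orients from the larger label to the smaller one. Put $\Sigma=\tau^{-1}\nu$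 and $F=\tau^{-1}\Sigma$. Let $h$ be the Coxeter number: $h=n+1$ for $A_n$, $h=2(n-1)$ for $D_n$, and $h=12,18,30$ for $E_6,E_7,E_8$. Then $f_{ad}$ and $f_{mu}$ exist and are unique, and 1. $f_{ad}\circ\Sigma=-f_{ad}$, and $f_{ad}\circ\tau^{-h}=f_{ad}$; 2. $f_{mu}\circ F=f_{mu}$, and $f_{mu}\circ\tau^{-(h+2)}=f_{mu}$. -/

import Mathlib

universe u v

/-- The simply laced Dynkin types `A_n` (`n ≥ 1`), `D_n` (`n ≥ 4`), `E_6`, `E_7`, `E_8`. -/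
inductive DynkinType : Type
  | A (n : ℕ) (hn : 1 ≤ n)
  | D (n : ℕ) (hn : 4 ≤ n)
  | E6
  | E7
  | E8

namespace DynkinType

/-- The number of vertices of the diagram. The vertex with label `k ∈ {1, …, n}` is the element
`k - 1` of `Fin T.rank`. -/
def rank : DynkinType → ℕ
  | A n _ => n
  | D n _ => n
  | E6 => 6
  | E7 => 7
  | E8 => 8

/-- The Coxeter number. -/
def coxeterNumber : DynkinType → ℕ
  | A n _ => n + 1
  | D n _ => 2 * (n - 1)
  | E6 => 12
  | E7 => 18
  | E8 => 30

/-- Every vertex other than the first one is joined to exactly one vertex with a smaller label;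
`prev` computes it (labels are shifted by one, so that they start from `0`). In terms of the labels
`1, …, n` the diagrams are
* `A_n`: the chain `1 - 2 - ⋯ - n`;
* `D_n`: the chain `1 - 2 - ⋯ - (n-1)` and one more edge `(n-2) - n`;
* `E_n`: the chain `1 - 2 - ⋯ - (n-1)` and one more edge `(n-3) - n`. -/
def prev : DynkinType → ℕ → ℕ
  | A _ _, k => k - 1
  | D n _, k => if k = n - 1 then n - 3 else k - 1
  | E6, k => if k = 5 then 2 else k - 1
  | E7, k => if k = 6 then 3 else k - 1
  | E8, k => if k = 7 then 4 else k - 1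

theorem prev_lt (T : DynkinType) {k : ℕ} (hk : 0 < k) : T.prev k < k := by
  cases T <;> simp only [prev] <;> (try split_ifs) <;> omega

/-- The arrows of the standard orientation: every edge is oriented from the smaller label to the
larger one. -/
def StdArrow (T : DynkinType) (i j : Fin T.rank) : Prop :=
  0 < j.val ∧ i.val = T.prev j.val

/-- Adjacency in the Dynkin diagram. -/
def Adj (T : DynkinType) (i j : Fin T.rank) : Prop :=
  T.StdArrow i j ∨ T.StdArrow j i

/-- The permutation of the vertices of the diagram underlying the Nakayama permutation. -/
def nuPerm : (T : DynkinType) → Fin T.rank → Fin T.rank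
  | A _ _, i => Fin.rev i
  | D n hn, i =>
      if Even n then i
      else Equiv.swap (⟨n - 2, by simp only [rank]; omega⟩ : Fin (D n hn).rank)
        ⟨n - 1, by simp only [rank]; omega⟩ i
  | E6, i => (![4, 3, 2, 1, 0, 5] : Fin 6 → Fin 6) i
  | E7, i => i
  | E8, i => i

/-- The number of levels by which the Nakayama permutation translates the vertex `i`, for the
standard orientation. -/
def nuShift : (T : DynkinType) → Fin T.rank → ℤ
  | A _ _, i => i.val
  | D n _, _ => (n : ℤ) - 2
  | E6, i => (![3, 4, 5, 6, 7, 5] : Fin 6 → ℤ) i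
  | E7, _ => 8
  | E8, _ => 14

/-- The Nakayama permutation of the vertices `(m, i)` of the repetition quiver of the standard
orientation. -/
def stdNakayama (T : DynkinType) (x : ℤ × Fin T.rank) : ℤ × Fin T.rank :=
  (x.1 + T.nuShift x.2, T.nuPerm x.2)

end DynkinType

/-- The vertices `(m, i)`, `m ∈ ℤ`, `i ∈ V`, of the repetition quiver of a quiver on `V`. -/
@[ext]
structure RepetitionQuiver (V : Type u) : Type u where
  level : ℤ
  vertex : V

namespace RepetitionQuiver

variable {V : Type u}

/-- Every arrow `i ⟶ j` of the given quiver yields an arrow `(m, i) ⟶ (m, j)` and an arrow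
`(m, j) ⟶ (m + 1, i)`, for all `m`; there are no other arrows. -/
instance [Quiver.{v} V] : Quiver.{v} (RepetitionQuiver V) where
  Hom a b := {_α : a.vertex ⟶ b.vertex // b.level = a.level} ⊕
    {_α : b.vertex ⟶ a.vertex // b.level = a.level + 1}

/-- The translation `τ (m, i) = (m - 1, i)`. -/
def tau : Equiv.Perm (RepetitionQuiver V) where
  toFun x := ⟨x.level - 1, x.vertex⟩
  invFun x := ⟨x.level + 1, x.vertex⟩
  left_inv x := by simp
  right_inv x := by simp

/-- Additive friezes on the repetition quiver of a finite quiver. The sum is over all arrows that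
end at `x`; there are finitely many. -/
def IsAdditiveFrieze [Quiver.{v} V] {R : Type*} [CommRing R]
    (f : RepetitionQuiver V → R) : Prop :=
  ∀ x, f (tau x) + f x = ∑ᶠ α : Σ w : RepetitionQuiver V, (w ⟶ x), f α.1

/-- Multiplicative friezes on the repetition quiver of a finite quiver. -/
def IsMultiplicativeFrieze [Quiver.{v} V] {R : Type*} [CommRing R]
    (f : RepetitionQuiver V → R) : Prop :=
  ∀ x, f (tau x) * f x = 1 + ∏ᶠ α : Σ w : RepetitionQuiver V, (w ⟶ x), f α.1

/-- `f` is the generic additive frieze `f_ad`: its value at `(0, i)` is the indeterminate `x_i`. -/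
def IsGenericAdditiveFrieze [Quiver.{v} V]
    (f : RepetitionQuiver V → MvPolynomial V ℤ) : Prop :=
  IsAdditiveFrieze f ∧ ∀ i : V, f ⟨0, i⟩ = MvPolynomial.X i

/-- `f` is the generic multiplicative frieze `f_mu`, with values in the field of rational functions
over `ℚ`: its value at `(0, i)` is the indeterminate `x_i`. -/
def IsGenericMultiplicativeFrieze [Quiver.{v} V]
    (f : RepetitionQuiver V → FractionRing (MvPolynomial V ℚ)) : Prop :=
  IsMultiplicativeFrieze f ∧
    ∀ i : V, f ⟨0, i⟩ = algebraMap (MvPolynomial V ℚ) _ (MvPolynomial.X i)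

end RepetitionQuiver

/-- A labelling of the vertices of a quiver that makes it a Dynkin quiver of type `T`: its
underlying unoriented graph is the Dynkin diagram. The orientation is arbitrary. -/
structure DynkinLabelling (T : DynkinType) (V : Type u) [Quiver.{v} V] where
  label : V ≃ Fin T.rank
  card_arrows : ∀ i j : V, T.Adj (label i) (label j) →
    ENat.card (i ⟶ j) + ENat.card (j ⟶ i) = 1
  isEmpty_arrows : ∀ i j : V, ¬ T.Adj (label i) (label j) → IsEmpty (i ⟶ j)

namespace DynkinLabelling

variable {T : DynkinType} {V : Type u} [Quiver.{v} V]

open Classical in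
/-- The number of edges on the path from the first vertex to the vertex `i` of the diagram that are
not oriented from the smaller label to the larger one. -/
noncomputable def reversals (L : DynkinLabelling T V) (i : Fin T.rank) : ℤ :=
  if h : 0 < i.val then
    L.reversals ⟨T.prev i.val, (T.prev_lt h).trans i.isLt⟩ +
      if Nonempty (L.label.symm i ⟶
        L.label.symm ⟨T.prev i.val, (T.prev_lt h).trans i.isLt⟩) then 1 else 0
  else 0
termination_by i.val
decreasing_by exact T.prev_lt h

/-- The isomorphism, on vertices, from the repetition quiver of a Dynkin quiver to the repetition
quiver of the standard orientation of the same diagram. -/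
noncomputable def toStandard (L : DynkinLabelling T V) :
    RepetitionQuiver V ≃ ℤ × Fin T.rank where
  toFun x := (x.level - L.reversals (L.label x.vertex), L.label x.vertex)
  invFun y := ⟨y.1 + L.reversals y.2, L.label.symm y.2⟩
  left_inv x := by simp
  right_inv y := by simp

/-- The Nakayama permutation `ν` of the repetition quiver. -/
noncomputable def nakayama (L : DynkinLabelling T V) (x : RepetitionQuiver V) :
    RepetitionQuiver V :=
  L.toStandard.symm (T.stdNakayama (L.toStandard x))

/-- `Σ = τ⁻¹ ν`. -/
noncomputable def serre (L : DynkinLabelling T V) (x : RepetitionQuiver V) :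
    RepetitionQuiver V :=
  RepetitionQuiver.tau⁻¹ (L.nakayama x)

/-- `F = τ⁻¹ Σ`. -/
noncomputable def frobenius (L : DynkinLabelling T V) (x : RepetitionQuiver V) :
    RepetitionQuiver V :=
  RepetitionQuiver.tau⁻¹ (L.serre x)

end DynkinLabelling

namespace DynkinType

variable (T : DynkinType)

instance : DecidableRel T.StdArrow := fun i j =>
  inferInstanceAs (Decidable (0 < j.val ∧ i.val = T.prev j.val))

instance : DecidableRel T.Adj := fun i j =>
  inferInstanceAs (Decidable (T.StdArrow i j ∨ T.StdArrow j i))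

theorem StdArrow.lt {T : DynkinType} {i j : Fin T.rank} (h : T.StdArrow i j) : i < j := by
  have := T.prev_lt h.1
  rw [← h.2] at this
  exact this

theorem StdArrow.asymm {T : DynkinType} {i j : Fin T.rank} (h : T.StdArrow i j) :
    ¬ T.StdArrow j i := fun h' => lt_asymm h.lt h'.lt

theorem Adj.symm {T : DynkinType} {i j : Fin T.rank} (h : T.Adj i j) : T.Adj j i := Or.symm h

/-- The neighbours of a vertex of the diagram. -/
def nbrs (i : Fin T.rank) : Finset (Fin T.rank) := Finset.univ.filter fun k => T.Adj k i

@[simp] theorem mem_nbrs {i k : Fin T.rank} : k ∈ T.nbrs i ↔ T.Adj k i := by simp [nbrs]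

/-- The arrow of the standard repetition quiver that joins a vertex over `k` to `(m, i)` starts at
`(m + offset k i, k)`. -/
def offset (k i : Fin T.rank) : ℤ := if T.StdArrow k i then 0 else -1

/-- The product of the values of `f` over the arrows that end at `(m, i)`. -/
@[to_additive /-- The sum of the values of `f` over the arrows that end at `(m, i)`. -/]
def meshProd {M : Type*} [CommMonoid M] (f : ℤ → Fin T.rank → M) (m : ℤ) (i : Fin T.rank) : M :=
  ∏ k ∈ T.nbrs i, f (m + T.offset k i) k

/-- The vertices `(s i, i)` form a slice of the standard repetition quiver. -/
def IsSlice (s : Fin T.rank → ℤ) : Prop := ∀ i j, T.StdArrow i j → s j ≤ s i ∧ s i ≤ s j + 1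

variable {T}

theorem isSlice_const (c : ℤ) : T.IsSlice fun _ => c := fun _ _ _ => ⟨le_refl c, (lt_add_one c).le⟩

theorem knit_forward {s : Fin T.rank → ℤ} (hs : T.IsSlice s) {P : ℤ → Fin T.rank → Prop}
    (h0 : ∀ i, P (s i) i)
    (hf : ∀ m i, s i < m → P (m - 1) i → (∀ k ∈ T.nbrs i, P (m + T.offset k i) k) → P m i)
    {c : ℤ} (hc : ∀ i, c ≤ s i) (d : ℕ) (i : Fin T.rank) (hi : s i ≤ c + d) : P (c + d) i := by
  induction d generalizing i with
  | zero =>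
    have := hc i
    obtain h : c + (0 : ℕ) = s i := by push_cast at *; omega
    rw [h]; exact h0 i
  | succ d ih =>
    induction i using WellFoundedLT.induction with
    | _ i ihi =>
    rcases hi.eq_or_lt with h | h
    · rw [← h]; exact h0 i
    · have e : c + ((d + 1 : ℕ) : ℤ) - 1 = c + d := by push_cast; ring
      refine hf _ i h ?_ ?_
      · rw [e]; exact ih i (by push_cast at h; omega)
      · intro k hk
        rw [mem_nbrs] at hk
        by_cases hki : T.StdArrow k i
        · have := hs _ _ hki
          simpa [offset, hki] using ihi k hki.lt (by omega)
        · have := hs _ _ (hk.resolve_left hki)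
          simp only [offset, hki, if_false]
          rw [← sub_eq_add_neg, e]
          exact ih k (by push_cast at h; omega)

theorem knit_backward {s : Fin T.rank → ℤ} (hs : T.IsSlice s) {P : ℤ → Fin T.rank → Prop}
    (h0 : ∀ i, P (s i) i)
    (hb : ∀ m i, m ≤ s i → P m i → (∀ k ∈ T.nbrs i, P (m + T.offset k i) k) → P (m - 1) i)
    {c : ℤ} (hc : ∀ i, s i ≤ c) (d : ℕ) (i : Fin T.rank) (hi : c - d ≤ s i) : P (c - d) i := by
  induction d generalizing i with
  | zero =>
    have := hc i
    obtain h : c - (0 : ℕ) = s i := by push_cast at *; omega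
    rw [h]; exact h0 i
  | succ d ih =>
    induction i using WellFoundedGT.induction with
    | _ i ihi =>
    rcases hi.eq_or_lt with h | h
    · rw [h]; exact h0 i
    · have e : c - ((d + 1 : ℕ) : ℤ) = c - d - 1 := by push_cast; ring
      rw [e] at hi h ⊢
      refine hb _ i (by omega) (ih i (by omega)) ?_
      · intro k hk
        rw [mem_nbrs] at hk
        by_cases hki : T.StdArrow k i
        · have := hs _ _ hki
          simpa [offset, hki] using ih k (by omega)
        · have hik := hk.resolve_left hki
          have := hs _ _ hik
          simp only [offset, hki, if_false]
          rw [← sub_eq_add_neg, ← e]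
          exact ihi k hik.lt (by omega)

/-- A property that holds on a slice and propagates through the meshes holds everywhere. -/
theorem knit_induction {s : Fin T.rank → ℤ} (hs : T.IsSlice s) {P : ℤ → Fin T.rank → Prop}
    (h0 : ∀ i, P (s i) i)
    (hf : ∀ m i, s i < m → P (m - 1) i → (∀ k ∈ T.nbrs i, P (m + T.offset k i) k) → P m i)
    (hb : ∀ m i, m ≤ s i → P m i → (∀ k ∈ T.nbrs i, P (m + T.offset k i) k) → P (m - 1) i)
    (m : ℤ) (i : Fin T.rank) : P m i := by
  obtain ⟨c, hc⟩ := (Set.finite_range s).bddBelow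
  obtain ⟨C, hC⟩ := (Set.finite_range s).bddAbove
  replace hc := fun i => hc (Set.mem_range_self i)
  replace hC := fun i => hC (Set.mem_range_self i)
  rcases le_total (s i) m with h | h
  · obtain ⟨d, hd⟩ := Int.eq_ofNat_of_zero_le (sub_nonneg.2 ((hc i).trans h))
    obtain rfl : m = c + d := by omega
    exact knit_forward hs h0 hf hc d i h
  · obtain ⟨d, hd⟩ := Int.eq_ofNat_of_zero_le (sub_nonneg.2 (h.trans (hC i)))
    obtain rfl : m = C - d := by omega
    exact knit_backward hs h0 hb hC d i h

/-- `f` is obtained from its values on the slice `s` by knitting with the rule `q`. -/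
@[to_additive IsAddKnit /-- `f` is obtained from its values on the slice `s` by knitting with the
rule `q`. -/]
def IsKnit {M : Type*} [CommMonoid M] (q : M → M → M) (s : Fin T.rank → ℤ)
    (f : ℤ → Fin T.rank → M) : Prop :=
  (∀ m i, s i < m → f m i = q (T.meshProd f m i) (f (m - 1) i)) ∧
    ∀ m i, m ≤ s i → f (m - 1) i = q (T.meshProd f m i) (f m i)

@[to_additive]
theorem IsKnit.unique {M : Type*} [CommMonoid M] {q : M → M → M} {s : Fin T.rank → ℤ}
    (hs : T.IsSlice s) {f g : ℤ → Fin T.rank → M} (hf : IsKnit q s f) (hg : IsKnit q s g)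
    (h : ∀ i, f (s i) i = g (s i) i) : f = g := by
  funext m i
  refine knit_induction (P := fun m i => f m i = g m i) hs h ?_ ?_ m i
  · intro m i hm h1 h2
    rw [hf.1 m i hm, hg.1 m i hm, h1]
    exact congrArg (q · _) (Finset.prod_congr rfl h2)
  · intro m i hm h1 h2
    rw [hf.2 m i hm, hg.2 m i hm, h1]
    exact congrArg (q · _) (Finset.prod_congr rfl h2)

/-- One step of the construction of a function by knitting. -/
@[to_additive addKnitStep /-- One step of the construction of a function by knitting. -/]
def knitStep {M : Type*} [CommMonoid M] (q : M → M → M) (s : Fin T.rank → ℤ)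
    (x : Fin T.rank → M) (f : ℤ → Fin T.rank → M) (m : ℤ) (i : Fin T.rank) : M :=
  if m = s i then x i
  else if s i < m then q (T.meshProd f m i) (f (m - 1) i)
  else q (T.meshProd f (m + 1) i) (f (m + 1) i)

open Filter in
@[to_additive exists_isAddKnit]
theorem exists_isKnit {M : Type*} [CommMonoid M] (q : M → M → M) {s : Fin T.rank → ℤ}
    (hs : T.IsSlice s) (x : Fin T.rank → M) :
    ∃ f : ℤ → Fin T.rank → M, IsKnit q s f ∧ ∀ i, f (s i) i = x i := by
  set a : ℕ → ℤ → Fin T.rank → M := fun d => (knitStep q s x)^[d] fun _ i => x i with ha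
  have succ : ∀ d, a (d + 1) = knitStep q s x (a d) := fun d =>
    Function.iterate_succ_apply' _ _ _
  have shift : ∀ {m i y}, (∀ᶠ d in atTop, a (d + 1) m i = y) → ∀ᶠ d in atTop, a d m i = y := by
    intro m i y h
    rw [← map_add_atTop_eq_nat 1]
    exact h
  have slice : ∀ d i, a d (s i) i = x i := by
    intro d i
    cases d with
    | zero => rfl
    | succ d => rw [succ]; simp [knitStep]
  have after : ∀ d m i, s i < m →
      a (d + 1) m i = q (T.meshProd (a d) m i) (a d (m - 1) i) := by
    intro d m i hm
    rw [succ]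
    simp [knitStep, hm, hm.ne']
  have before : ∀ d m i, m ≤ s i →
      a (d + 1) (m - 1) i = q (T.meshProd (a d) m i) (a d m i) := by
    intro d m i hm
    rw [succ]
    simp [knitStep, show m - 1 ≠ s i by omega, show ¬ s i < m - 1 by omega]
  have key : ∀ m i, ∃ y, ∀ᶠ d in atTop, a d m i = y := by
    refine knit_induction hs ?_ ?_ ?_
    · intro i
      exact ⟨x i, Eventually.of_forall fun d => slice d i⟩
    · rintro m i hm ⟨y, hy⟩ h2
      choose! z hz using h2
      refine ⟨q (∏ k ∈ T.nbrs i, z k) y, shift ?_⟩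
      filter_upwards [hy, (eventually_all_finset _).2 hz] with d h1 h2
      rw [after d m i hm, h1]
      exact congrArg (q · _) (Finset.prod_congr rfl h2)
    · rintro m i hm ⟨y, hy⟩ h2
      choose! z hz using h2
      refine ⟨q (∏ k ∈ T.nbrs i, z k) y, shift ?_⟩
      filter_upwards [hy, (eventually_all_finset _).2 hz] with d h1 h2
      rw [before d m i hm, h1]
      exact congrArg (q · _) (Finset.prod_congr rfl h2)
  choose f hf using key
  have hf' : ∀ m i, ∀ᶠ d in atTop, a (d + 1) m i = f m i := fun m i =>
    (tendsto_add_atTop_nat 1).eventually (hf m i)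
  have mesh : ∀ m i, ∀ᶠ d in atTop, T.meshProd (a d) m i = T.meshProd f m i := by
    intro m i
    filter_upwards [(eventually_all_finset (T.nbrs i)).2 fun k _ => hf (m + T.offset k i) k]
      with d h
    exact Finset.prod_congr rfl h
  refine ⟨f, ⟨fun m i hm => ?_, fun m i hm => ?_⟩, fun i => ?_⟩
  · obtain ⟨d, h1, h2, h3⟩ := ((hf' m i).and ((hf (m - 1) i).and (mesh m i))).exists
    rw [← h1, ← h2, ← h3, after d m i hm]
  · obtain ⟨d, h1, h2, h3⟩ := ((hf' (m - 1) i).and ((hf m i).and (mesh m i))).exists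
    rw [← h1, ← h2, ← h3, before d m i hm]
  · obtain ⟨d, h⟩ := (hf (s i) i).exists
    rw [← h, slice]

end DynkinType

namespace DynkinType

theorem val_nuPerm_A {n : ℕ} {hn : 1 ≤ n} (i : Fin (A n hn).rank) :
    ((A n hn).nuPerm i).val = n - 1 - i.val := by
  have := Fin.val_rev i
  simp only [nuPerm, rank] at *
  omega

theorem val_nuPerm_D {n : ℕ} {hn : 4 ≤ n} (i : Fin (D n hn).rank) :
    ((D n hn).nuPerm i).val = if Even n then i.val else if i.val = n - 2 then n - 1
      else if i.val = n - 1 then n - 2 else i.val := by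
  simp only [nuPerm, Equiv.swap_apply_def, Fin.ext_iff]
  split_ifs <;> rfl

theorem nuPerm_nuPerm (T : DynkinType) (i : Fin T.rank) : T.nuPerm (T.nuPerm i) = i := by
  cases T with
  | A n hn => exact Fin.rev_rev i
  | D n hn =>
    simp only [nuPerm]
    split_ifs
    · rfl
    · exact (Equiv.swap _ _).symm_apply_apply i
  | E6 => revert i; decide
  | E7 => rfl
  | E8 => rfl

theorem nuShift_nonneg (T : DynkinType) (i : Fin T.rank) : 0 ≤ T.nuShift i := by
  cases T with
  | A n hn => exact Int.natCast_nonneg _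
  | D n hn => simp only [nuShift]; omega
  | E6 => revert i; decide
  | E7 => simp [nuShift]
  | E8 => simp [nuShift]

theorem nuShift_add_nuShift (T : DynkinType) (i : Fin T.rank) :
    T.nuShift i + T.nuShift (T.nuPerm i) = T.coxeterNumber - 2 := by
  cases T with
  | A n hn =>
    have : i.val < n := i.isLt
    simp only [nuShift, val_nuPerm_A, coxeterNumber]
    omega
  | D n hn => simp only [nuShift, coxeterNumber]; omega
  | E6 => revert i; decide
  | E7 => simp [nuShift, coxeterNumber]
  | E8 => simp [nuShift, coxeterNumber]

theorem adj_nuPerm (T : DynkinType) {i j : Fin T.rank} (h : T.Adj i j) :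
    T.Adj (T.nuPerm i) (T.nuPerm j) := by
  cases T with
  | A n hn =>
    have : i.val < n := i.isLt
    have : j.val < n := j.isLt
    simp only [Adj, StdArrow, prev, val_nuPerm_A] at *
    omega
  | D n hn =>
    have : i.val < n := i.isLt
    have : j.val < n := j.isLt
    simp only [Adj, StdArrow, prev, val_nuPerm_D] at *
    split_ifs at * <;> omega
  | E6 => revert i j; decide
  | E7 => exact h
  | E8 => exact h

theorem nuShift_add_offset (T : DynkinType) {i j : Fin T.rank} (h : T.Adj j i) :
    T.nuShift j + T.offset j i = T.nuShift i + T.offset (T.nuPerm j) (T.nuPerm i) := by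
  cases T with
  | A n hn =>
    have : i.val < n := i.isLt
    have : j.val < n := j.isLt
    simp only [Adj, offset, StdArrow, prev, val_nuPerm_A, nuShift] at *
    split_ifs <;> omega
  | D n hn =>
    have : i.val < n := i.isLt
    have : j.val < n := j.isLt
    simp only [Adj, offset, StdArrow, prev, val_nuPerm_D, nuShift, add_right_inj] at *
    refine if_congr ?_ rfl rfl
    split_ifs at * <;> omega
  | E6 => revert i j; decide
  | E7 => rfl
  | E8 => rfl

end DynkinType

namespace DynkinType

/-- `H` is the hammock function of the vertex `(0, j)` of the standard repetition quiver: it lives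
between the slice of `(0, j)` and its image under the Nakayama permutation, and it is additive but
for the defects at `(0, j)` and at its image under `τ⁻¹ ν`. -/
structure IsHammock (T : DynkinType) (j : Fin T.rank) (H : ℤ → Fin T.rank → ℤ) : Prop where
  nonneg : ∀ m i, 0 ≤ H m i
  support : ∀ m i, H m i ≠ 0 → 0 ≤ m ∧ m ≤ T.nuShift (T.nuPerm i)
  mesh : ∀ m i, H (m - 1) i + H m i = T.meshSum H m i + (if m = 0 ∧ i = j then 1 else 0) +
    (if m = T.nuShift j + 1 ∧ i = T.nuPerm j then 1 else 0)
  first : ∀ i, T.StdArrow i j → H 0 i = 0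
  last : ∀ k, T.StdArrow j k → H (T.nuShift k) (T.nuPerm k) = 0

theorem meshSum_eq (T : DynkinType) (F : ℤ → ℕ → ℤ) (m : ℤ) (i : Fin T.rank) :
    T.meshSum (fun m k => F m k.val) m i = (if 0 < i.val then F m (T.prev i.val) else 0) +
      ∑ k with T.StdArrow i k, F (m - 1) k.val := by
  have h : T.nbrs i = (Finset.univ.filter fun k => T.StdArrow k i) ∪
      Finset.univ.filter fun k => T.StdArrow i k := by
    ext k; simp [Adj]
  have hd : Disjoint (Finset.univ.filter fun k => T.StdArrow k i)
      (Finset.univ.filter fun k => T.StdArrow i k) :=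
    Finset.disjoint_filter.2 fun k _ h1 h2 => h1.asymm h2
  rw [meshSum, h, Finset.sum_union hd]
  congr 1
  · split_ifs with h0
    · have : (Finset.univ.filter fun k => T.StdArrow k i) =
          {⟨T.prev i.val, (T.prev_lt h0).trans i.isLt⟩} := by
        ext k; simp [StdArrow, h0, Fin.ext_iff]
      rw [this, Finset.sum_singleton]
      have h1 : T.StdArrow ⟨T.prev i.val, (T.prev_lt h0).trans i.isLt⟩ i := ⟨h0, rfl⟩
      simp [offset, h1]
    · refine Finset.sum_eq_zero fun k hk => ?_
      exact absurd (Finset.mem_filter.1 hk).2.1 h0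
  · refine Finset.sum_congr rfl fun k hk => ?_
    have h1 : ¬ T.StdArrow k i := (Finset.mem_filter.1 hk).2.asymm
    simp [offset, h1, sub_eq_add_neg]

theorem sum_children_A {n : ℕ} {hn : 1 ≤ n} (F : ℕ → ℤ) (i : Fin (A n hn).rank) :
    (∑ k with (A n hn).StdArrow i k, F k.val) = if i.val + 1 < n then F (i.val + 1) else 0 := by
  split_ifs with h
  · have : (Finset.univ.filter fun k => (A n hn).StdArrow i k) =
        {(⟨i.val + 1, h⟩ : Fin (A n hn).rank)} := by
      ext k
      rw [Finset.mem_filter_univ]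
      simp only [StdArrow, prev, Finset.mem_singleton, Fin.ext_iff]
      omega
    rw [this, Finset.sum_singleton]
  · refine Finset.sum_eq_zero fun k hk => ?_
    have hk' : k.val < n := k.isLt
    rw [Finset.mem_filter_univ] at hk
    simp only [StdArrow, prev] at hk
    omega

theorem sum_children_D {n : ℕ} {hn : 4 ≤ n} (F : ℕ → ℤ) (i : Fin (D n hn).rank) :
    (∑ k with (D n hn).StdArrow i k, F k.val) = if i.val + 3 < n then F (i.val + 1)
      else if i.val + 3 = n then F (n - 2) + F (n - 1) else 0 := by
  split_ifs with h h'
  · have : (Finset.univ.filter fun k => (D n hn).StdArrow i k) =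
        {(⟨i.val + 1, by simp only [rank]; omega⟩ : Fin (D n hn).rank)} := by
      ext k
      have hk' : k.val < n := k.isLt
      rw [Finset.mem_filter_univ]
      simp only [StdArrow, prev, Finset.mem_singleton, Fin.ext_iff]
      split_ifs <;> omega
    rw [this, Finset.sum_singleton]
  · have : (Finset.univ.filter fun k => (D n hn).StdArrow i k) =
        {(⟨n - 2, by simp only [rank]; omega⟩ : Fin (D n hn).rank),
          (⟨n - 1, by simp only [rank]; omega⟩ : Fin (D n hn).rank)} := by
      ext k
      have hk' : k.val < n := k.isLt
      rw [Finset.mem_filter_univ]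
      simp only [StdArrow, prev, Finset.mem_singleton, Fin.ext_iff,
        Finset.mem_insert]
      split_ifs <;> omega
    rw [this, Finset.sum_pair (by simp only [ne_eq, Fin.ext_iff]; omega)]
  · refine Finset.sum_eq_zero fun k hk => ?_
    have hk' : k.val < n := k.isLt
    rw [Finset.mem_filter_univ] at hk
    simp only [StdArrow, prev] at hk
    split_ifs at hk <;> omega

/-- The hammock of `(0, j)` in type `A_n`. -/
def hammockA (n j : ℕ) (m : ℤ) (i : ℕ) : ℤ :=
  if 0 ≤ m ∧ m ≤ j ∧ (j : ℤ) ≤ m + i ∧ m + i < n then 1 else 0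

theorem isHammock_A {n : ℕ} {hn : 1 ≤ n} (j : Fin (A n hn).rank) :
    (A n hn).IsHammock j fun m i => hammockA n j.val m i.val := by
  have hj : j.val < n := j.isLt
  constructor
  · intro m i
    simp only [hammockA]
    split_ifs <;> omega
  · intro m i
    have hi : i.val < n := i.isLt
    simp only [hammockA, nuShift, val_nuPerm_A]
    split_ifs <;> omega
  · intro m i
    have hi : i.val < n := i.isLt
    rw [meshSum_eq, sum_children_A fun k => hammockA n j.val (m - 1) k]
    simp only [hammockA, nuShift, val_nuPerm_A, Fin.ext_iff, prev]
    split_ifs <;> omega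
  · intro i
    simp only [hammockA, StdArrow, prev]
    split_ifs <;> omega
  · intro k
    have hk : k.val < n := k.isLt
    simp only [hammockA, nuShift, val_nuPerm_A, StdArrow, prev]
    split_ifs <;> omega

/-- The hammock of `(0, j)` in type `D_n`. -/
def hammockD (n j : ℕ) (m : ℤ) (i : ℕ) : ℤ :=
  if j + 2 < n then
    if i + 2 < n then
      (if 0 ≤ m ∧ m ≤ j ∧ (j : ℤ) ≤ m + i then 1 else 0) +
        if m + 2 ≤ n ∧ (n : ℤ) ≤ m + i + 2 ∧ m + i + 2 ≤ j + n then 1 else 0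
    else if 0 ≤ m ∧ m ≤ j then 1 else 0
  else if i + 2 < n then if 0 ≤ m ∧ m + 2 ≤ n ∧ (n : ℤ) ≤ m + i + 2 then 1 else 0
  else if 0 ≤ m ∧ m + 2 ≤ n ∧ (m % 2 = 0 ↔ i = j) then 1 else 0

theorem hammockD_mesh_chain {n j i : ℕ} (hj : j + 2 < n) (hi : i + 2 < n) (m : ℤ) :
    hammockD n j (m - 1) i + hammockD n j m i = (if 0 < i then hammockD n j m (i - 1) else 0) +
      (if i + 3 < n then hammockD n j (m - 1) (i + 1)
        else hammockD n j (m - 1) (n - 2) + hammockD n j (m - 1) (n - 1)) +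
      (if m = 0 ∧ i = j then 1 else 0) + if m = n - 2 + 1 ∧ i = j then 1 else 0 := by
  have e1 : i - 1 + 2 < n := by omega
  have e2 : ¬ n - 2 + 2 < n := by omega
  have e3 : ¬ n - 1 + 2 < n := by omega
  have e4 : i + 1 + 2 < n ↔ i + 3 < n := by omega
  simp only [hammockD, hj, hi, e1, e2, e3, e4, if_true, if_false]
  have f1 : ((if 0 ≤ m - 1 ∧ m - 1 ≤ j ∧ (j : ℤ) ≤ m - 1 + i then 1 else 0) +
      if 0 ≤ m ∧ m ≤ j ∧ (j : ℤ) ≤ m + i then 1 else 0 : ℤ) =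
      (if 0 < i ∧ 0 ≤ m ∧ m ≤ j ∧ (j : ℤ) ≤ m + (i - 1 : ℕ) then 1 else 0) +
      (if 0 ≤ m - 1 ∧ m - 1 ≤ j ∧ (j : ℤ) ≤ m - 1 + (i + 1 : ℕ) then 1 else 0) +
      if m = 0 ∧ i = j then 1 else 0 := by
    split_ifs <;> omega
  have f2 : ((if m - 1 + 2 ≤ n ∧ (n : ℤ) ≤ m - 1 + i + 2 ∧ m - 1 + i + 2 ≤ j + n then 1 else 0) +
      if m + 2 ≤ n ∧ (n : ℤ) ≤ m + i + 2 ∧ m + i + 2 ≤ j + n then 1 else 0 : ℤ) =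
      (if 0 < i ∧ m + 2 ≤ n ∧ (n : ℤ) ≤ m + (i - 1 : ℕ) + 2 ∧ m + (i - 1 : ℕ) + 2 ≤ j + n
        then 1 else 0) +
      (if m - 1 + 2 ≤ n ∧ (n : ℤ) ≤ m - 1 + (i + 1 : ℕ) + 2 ∧ m - 1 + (i + 1 : ℕ) + 2 ≤ j + n
        then 1 else 0) + if m = n - 2 + 1 ∧ i = j then 1 else 0 := by
    split_ifs <;> omega
  have f3 : ¬ i + 3 < n →
      ((0 ≤ m - 1 ∧ m - 1 ≤ j ∧ (j : ℤ) ≤ m - 1 + (i + 1 : ℕ)) ↔ 0 ≤ m - 1 ∧ m - 1 ≤ j) := by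
    omega
  have f4 : ¬ i + 3 < n → ((m - 1 + 2 ≤ n ∧ (n : ℤ) ≤ m - 1 + (i + 1 : ℕ) + 2 ∧
      m - 1 + (i + 1 : ℕ) + 2 ≤ j + n) ↔ 0 ≤ m - 1 ∧ m - 1 ≤ j) := by
    omega
  by_cases h0 : 0 < i <;> by_cases h3 : i + 3 < n <;>
    simp only [h0, h3, f3, f4, if_true, if_false, true_and, false_and,
      not_false_eq_true] at f1 f2 ⊢ <;> linarith

theorem hammockD_mesh_tip {n j i : ℕ} (hn : 4 ≤ n) (hj : ¬ j + 2 < n) (hi : ¬ i + 2 < n) (m : ℤ) :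
    hammockD n j (m - 1) i + hammockD n j m i = hammockD n j m (n - 3) +
      (if m = 0 ∧ i = j then 1 else 0) +
      if m = n - 2 + 1 ∧ (n % 2 = 0 ↔ i = j) then 1 else 0 := by
  have e : n - 3 + 2 < n := by omega
  simp only [hammockD, hj, hi, e, if_true, if_false]
  by_cases h : i = j
  · simp only [h, iff_true, and_true]
    split_ifs <;> omega
  · simp only [h, iff_false, and_false, if_false]
    split_ifs <;> omega

theorem hammockD_mesh {n j i : ℕ} (hn : 4 ≤ n) (hj : j < n) (hi : i < n) (m : ℤ) :
    hammockD n j (m - 1) i + hammockD n j m i =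
      (if 0 < i then hammockD n j m (if i = n - 1 then n - 3 else i - 1) else 0) +
      (if i + 3 < n then hammockD n j (m - 1) (i + 1) else if i + 3 = n then
        hammockD n j (m - 1) (n - 2) + hammockD n j (m - 1) (n - 1) else 0) +
      (if m = 0 ∧ i = j then 1 else 0) +
      (if m = (n : ℤ) - 2 + 1 ∧ i = if n % 2 = 0 then j else if j = n - 2 then n - 1
        else if j = n - 1 then n - 2 else j then 1 else 0) := by
  have e2 : ¬ n - 2 + 2 < n := by omega
  have e3 : ¬ n - 1 + 2 < n := by omega
  have e5 : n - 3 + 2 < n := by omega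
  by_cases hi2 : i + 2 < n
  · have e6 : i ≠ n - 1 := by omega
    have e9 : ¬ i + 3 < n → i + 3 = n := by omega
    by_cases hj2 : j + 2 < n
    · have e7 : j ≠ n - 1 := by omega
      have e8 : j ≠ n - 2 := by omega
      rw [hammockD_mesh_chain hj2 hi2]
      simp only [e6, e7, e8, if_false, ite_self]
      split_ifs <;> omega
    · have e1 : i - 1 + 2 < n := by omega
      have e4 : i + 1 + 2 < n ↔ i + 3 < n := by omega
      have e7 : i ≠ j := by omega
      have e8 : ¬ i = if n % 2 = 0 then j else if j = n - 2 then n - 1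
        else if j = n - 1 then n - 2 else j := by split_ifs <;> omega
      simp only [hammockD, hj2, hi2, e1, e2, e3, e4, e6, e7, e8, and_false, if_true, if_false]
      by_cases h0 : 0 < i <;> by_cases h3 : i + 3 < n
      · simp only [h0, h3, if_true]
        split_ifs <;> omega
      · simp only [h0, h3, if_true, if_false]
        split_ifs <;> omega
      · simp only [h0, h3, if_true, if_false]
        split_ifs <;> omega
      · omega
  · have e6 : (if i = n - 1 then n - 3 else i - 1) = n - 3 := by split_ifs <;> omega
    have e7 : ¬ i + 3 < n := by omega
    have e8 : i + 3 ≠ n := by omega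
    have e9 : 0 < i := by omega
    simp only [e6, e7, e8, e9, if_true, if_false]
    by_cases hj2 : j + 2 < n
    · have e10 : i ≠ j := by omega
      have e11 : ¬ i = if n % 2 = 0 then j else if j = n - 2 then n - 1
        else if j = n - 1 then n - 2 else j := by split_ifs <;> omega
      simp only [hammockD, hj2, hi2, e5, e10, e11, and_false, if_true, if_false]
      split_ifs <;> omega
    · rw [hammockD_mesh_tip hn hj2 hi2]
      split_ifs <;> omega

theorem isHammock_D {n : ℕ} {hn : 4 ≤ n} (j : Fin (D n hn).rank) :
    (D n hn).IsHammock j fun m i => hammockD n j.val m i.val := by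
  have hj : j.val < n := j.isLt
  constructor
  · intro m i
    simp only [hammockD]
    split_ifs <;> omega
  · intro m i
    have hi : i.val < n := i.isLt
    simp only [hammockD, nuShift]
    split_ifs <;> omega
  · intro m i
    have hi : i.val < n := i.isLt
    rw [meshSum_eq, sum_children_D fun k => hammockD n j.val (m - 1) k]
    simp only [nuShift, val_nuPerm_D, Fin.ext_iff, prev, Nat.even_iff]
    exact hammockD_mesh hn hj hi m
  · intro i
    simp only [hammockD, StdArrow, prev]
    split_ifs <;> omega
  · intro k
    have hk : k.val < n := k.isLt
    simp only [hammockD, nuShift, val_nuPerm_D, StdArrow, prev, Nat.even_iff]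
    split_ifs <;> omega

/-- The function on `ℤ × Fin n` whose values are the hexadecimal digits of `c`. -/
def digitTable (n c : ℕ) (m : ℤ) (i : Fin n) : ℤ :=
  if 0 ≤ m then ((c / 16 ^ (n * m.toNat + i.val) % 16 : ℕ) : ℤ) else 0

theorem digitTable_eq_zero {n c N : ℕ} (hc : c < 16 ^ (n * N)) {m : ℤ} (hm : m < 0 ∨ (N : ℤ) ≤ m)
    (i : Fin n) : digitTable n c m i = 0 := by
  rw [digitTable]
  split_ifs with h
  · have : c < 16 ^ (n * m.toNat + i.val) := hc.trans_le <| Nat.pow_le_pow_right (by norm_num) <|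
      (Nat.mul_le_mul_left n (by omega : N ≤ m.toNat)).trans (Nat.le_add_right _ _)
    rw [Nat.div_eq_of_lt this]
    rfl
  · rfl

theorem isHammock_digitTable {T : DynkinType} {j : Fin T.rank} {c N : ℕ}
    (hc : c < 16 ^ (T.rank * N)) (hN : T.nuShift j ≤ N)
    (support : ∀ k : Fin N, ∀ i, digitTable T.rank c k.val i ≠ 0 →
      (k.val : ℤ) ≤ T.nuShift (T.nuPerm i))
    (mesh : ∀ k : Fin (N + 2), ∀ i,
      digitTable T.rank c (k.val - 1) i + digitTable T.rank c k.val i =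
      T.meshSum (digitTable T.rank c) k.val i + (if (k.val : ℤ) = 0 ∧ i = j then 1 else 0) +
      (if (k.val : ℤ) = T.nuShift j + 1 ∧ i = T.nuPerm j then 1 else 0))
    (first : ∀ i, T.StdArrow i j → digitTable T.rank c 0 i = 0)
    (last : ∀ k, T.StdArrow j k → digitTable T.rank c (T.nuShift k) (T.nuPerm k) = 0) :
    T.IsHammock j (digitTable T.rank c) := by
  refine ⟨fun m i => ?_, fun m i hm => ?_, fun m i => ?_, first, last⟩
  · rw [digitTable]
    split_ifs <;> omega
  · by_cases h : m < 0 ∨ (N : ℤ) ≤ m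
    · exact absurd (digitTable_eq_zero hc h i) hm
    · obtain ⟨k, rfl⟩ := Int.eq_ofNat_of_zero_le (by omega : 0 ≤ m)
      exact ⟨by omega, support ⟨k, by omega⟩ i hm⟩
  · by_cases h : m < 0 ∨ (N : ℤ) + 2 ≤ m
    · have := T.nuShift_nonneg j
      have hs : T.meshSum (digitTable T.rank c) m i = 0 := Finset.sum_eq_zero fun k _ =>
        digitTable_eq_zero hc (by rw [offset]; split_ifs <;> omega) k
      rw [hs, digitTable_eq_zero hc (by omega), digitTable_eq_zero hc (by omega), if_neg (by omega),
        if_neg (by omega)]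
      rfl
    · obtain ⟨k, rfl⟩ := Int.eq_ofNat_of_zero_le (by omega : 0 ≤ m)
      exact mesh ⟨k, by omega⟩ i

/-- The hammocks of type `E_6`: the digit of weight `16 ^ (6 * m + i)` of the entry with index `j` is
the value at `(m, i)` of the hammock that starts at `(0, j)`. -/
def tableE6 : Fin E6.rank → ℕ :=
  ![0x11111100110001100111111,
    0x1111111221101210112211111110,
    0x111101221112321212321112210111100,
    0x11000110101211112221111210101100011000,
    0x1000010000100101111011110100100001000010000,
    0x100111001110111211101110011100100000]

/-- The hammocks of type `E_7`: the digit of weight `16 ^ (7 * m + i)` of the entry with index `j` is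
the value at `(m, i)` of the hammock that starts at `(0, j)`. -/
def tableE7 : Fin E7.rank → ℕ :=
  ![0x100000100000100000100010111110111110100110000110001111111,
    0x1100001100001100101211111222211112210101210011221111111110,
    0x11100011101012211112322121233211123210212321111221101111100,
    0x111110122211123321212432121343212234321212321011221001111000,
    0x1111111122211012210112321121232211122210111210010110000110000,
    0x11111110011100011100111211110111100111100100100000100000100000,
    0x100111100111101112211101211011222111112110101110001110001000000]

/-- The hammocks of type `E_8`: the digit of weight `16 ^ (8 * m + i)` of the entry with index `j` is
the value at `(m, i)` of the hammock that starts at `(0, j)`. -/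
def tableE8 : Fin E8.rank → ℕ :=
  ![0x10000001000000100000010000001000010111111011111101001110000111000111211111011111001111100100110000011000011111111,
    0x110000011000001100000110001012111111222221111222101012210011232111212322211122221011122100101210001122111111111110,
    0x1110000111000011100101221111123222121233321112332102124321121343221223433212123321011232100212321111122111011111100,
    0x11110001111010122211112332212124332121344321223543213135432122454321323543212134321022343211212321101122110011111000,
    0x111111012222111233321212443212135432132465432324654313246542132465321324643213245432122343210212321001122100011110000,
    0x1111111112222110122210112332112124322121343321223443212124321021343211223432212123221011222100111210001011000001100000,
    0x11111111001111000111100111221111012111011222211111221101012110011222111111211101011110001111000100100000010000001000000,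
    0x100111110011111011122211101221101123221121233221112322102123321111232110212322111122211011121100101110000111000010000000]

theorem isHammock_E6 (j : Fin E6.rank) : E6.IsHammock j (digitTable E6.rank (tableE6 j)) := by
  refine isHammock_digitTable (T := E6) (N := 8) ?_ ?_ ?_ ?_ ?_ ?_ <;> revert j <;> decide +kernel

theorem isHammock_E7 (j : Fin E7.rank) : E7.IsHammock j (digitTable E7.rank (tableE7 j)) := by
  refine isHammock_digitTable (T := E7) (N := 9) ?_ ?_ ?_ ?_ ?_ ?_ <;> revert j <;> decide +kernel

theorem isHammock_E8 (j : Fin E8.rank) : E8.IsHammock j (digitTable E8.rank (tableE8 j)) := by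
  refine isHammock_digitTable (T := E8) (N := 15) ?_ ?_ ?_ ?_ ?_ ?_ <;> revert j <;> decide +kernel

theorem exists_isHammock (T : DynkinType) (j : Fin T.rank) : ∃ H, T.IsHammock j H := by
  cases T with
  | A n hn => exact ⟨_, isHammock_A j⟩
  | D n hn => exact ⟨_, isHammock_D j⟩
  | E6 => exact ⟨_, isHammock_E6 j⟩
  | E7 => exact ⟨_, isHammock_E7 j⟩
  | E8 => exact ⟨_, isHammock_E8 j⟩

end DynkinType

namespace DynkinType

variable {T : DynkinType}

theorem Adj.ne {i k : Fin T.rank} (h : T.Adj k i) : k ≠ i := by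
  rintro rfl
  rcases h with h | h <;> exact lt_irrefl _ h.lt

theorem offset_add_offset {i k : Fin T.rank} (h : T.Adj k i) :
    T.offset k i + T.offset i k = -1 := by
  rcases h with h | h <;> simp [offset, h, h.asymm]

theorem offset_le (k i : Fin T.rank) : T.offset k i ≤ 0 ∧ -1 ≤ T.offset k i := by
  rw [offset]; split_ifs <;> simp

theorem adj_nuPerm_comm {k i : Fin T.rank} : T.Adj (T.nuPerm k) i ↔ T.Adj k (T.nuPerm i) := by
  constructor <;> intro h
  · simpa [nuPerm_nuPerm] using T.adj_nuPerm h
  · simpa [nuPerm_nuPerm] using T.adj_nuPerm h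

/-- The function `f ∘ τ ^ (-c) ∘ ν` on the standard repetition quiver. -/
def twist {M : Type*} (c : ℤ) (f : ℤ → Fin T.rank → M) (m : ℤ) (i : Fin T.rank) : M :=
  f (m + T.nuShift i + c) (T.nuPerm i)

@[to_additive]
theorem meshProd_twist {M : Type*} [CommMonoid M] (c : ℤ) (f : ℤ → Fin T.rank → M) (m : ℤ)
    (i : Fin T.rank) :
    T.meshProd (twist c f) m i = T.meshProd f (m + T.nuShift i + c) (T.nuPerm i) := by
  refine Finset.prod_bij (fun k _ => T.nuPerm k) (fun k hk => ?_) (fun k _ l _ h => ?_)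
    (fun k hk => ⟨T.nuPerm k, ?_, T.nuPerm_nuPerm k⟩) fun k hk => ?_
  · rw [mem_nbrs] at *
    exact T.adj_nuPerm hk
  · rw [← T.nuPerm_nuPerm k, h, T.nuPerm_nuPerm]
  · rw [mem_nbrs] at *
    exact adj_nuPerm_comm.2 hk
  · rw [mem_nbrs] at hk
    have := T.nuShift_add_offset hk
    rw [twist]
    congr 1
    linarith

@[to_additive]
theorem meshProd_shift {M : Type*} [CommMonoid M] (c : ℤ) (f : ℤ → Fin T.rank → M) (m : ℤ)
    (i : Fin T.rank) :
    T.meshProd (fun m k => f (m + c) k) m i = T.meshProd f (m + c) i :=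
  Finset.prod_congr rfl fun k _ => by rw [add_right_comm]

namespace IsHammock

variable {j : Fin T.rank} {H : ℤ → Fin T.rank → ℤ}

theorem finite_support (hH : T.IsHammock j H) (c : ℤ) (i : Fin T.rank) :
    {m | H (m + c) i ≠ 0}.Finite :=
  (Set.finite_Icc (-c) (T.nuShift (T.nuPerm i) - c)).subset fun m hm => by
    have := hH.support _ _ hm
    simp only [Set.mem_Icc]
    omega

/-- An additive function changes its sign along the hammock. -/
theorem add_eq_zero {R : Type*} [CommRing R] (hH : T.IsHammock j H) {f : ℤ → Fin T.rank → R}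
    (hf : ∀ m i, f (m - 1) i + f m i = T.meshSum f m i) :
    f 0 j + f (T.nuShift j + 1) (T.nuPerm j) = 0 := by
  let B (k i : Fin T.rank) (d : ℤ) : R := ∑ᶠ m, (H m k : R) * f (m + d) i
  have fin : ∀ (c d : ℤ) (k i : Fin T.rank),
      Function.HasFiniteSupport fun m => (H (m + c) k : R) * f (m + d) i := fun c d k i =>
    (hH.finite_support c k).subset fun m hm hm' => hm (by simp [hm'])
  have hB : ∀ (k i : Fin T.rank) (c : ℤ),
      ∑ᶠ m, (H (m + c) k : R) * f m i = B k i (-c) := by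
    intro k i c
    have := finsum_comp_equiv (Equiv.addRight c) (f := fun m => (H m k : R) * f (m + -c) i)
    simpa using this
  have h1 : ∀ i, B i i 1 + B i i 0 = ∑ k ∈ T.nbrs i, B i k (1 + T.offset k i) := by
    intro i
    rw [← finsum_add_distrib (by simpa using fin 0 1 i i) (by simpa using fin 0 0 i i),
      ← finsum_sum_comm _ _ fun k _ => by simpa using fin 0 (1 + T.offset k i) i k]
    refine finsum_congr fun m => ?_
    rw [← mul_add, ← Finset.mul_sum, add_zero, add_comm (f (m + 1) i)]
    have := hf (m + 1) i
    rw [add_sub_cancel_right] at this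
    rw [this, meshSum]
    simp only [add_assoc]
  have h2 : ∀ i, ∑ᶠ m, (T.meshSum (fun m k => (H m k : R)) m i) * f m i =
      ∑ k ∈ T.nbrs i, B k i (-T.offset k i) := by
    intro i
    simp only [meshSum, Finset.sum_mul]
    rw [finsum_sum_comm _ _ fun k _ => by simpa using fin (T.offset k i) 0 k i]
    exact Finset.sum_congr rfl fun k _ => hB k i _
  have h3 : ∑ i, ∑ᶠ m, ((H (m - 1) i : R) + H m i) * f m i =
      ∑ i, ∑ᶠ m, (T.meshSum (fun m k => (H m k : R)) m i) * f m i := by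
    have h4 : ∀ i, ∑ᶠ m, ((H (m - 1) i : R) + H m i) * f m i = B i i 1 + B i i 0 := by
      intro i
      simp only [add_mul, sub_eq_add_neg]
      rw [finsum_add_distrib (by simpa using fin (-1) 0 i i) (by simpa using fin 0 0 i i), hB,
        neg_neg]
      congr 1
      simpa using hB i i 0
    simp only [h4, h1, h2]
    rw [Finset.sum_comm' (t' := Finset.univ) (s' := fun k => T.nbrs k)
      (by intro x y; simpa using ⟨Or.symm, Or.symm⟩)]
    refine Finset.sum_congr rfl fun i _ => Finset.sum_congr rfl fun k hk => ?_
    have := offset_add_offset ((T.mem_nbrs).1 hk)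
    congr 1
    linarith
  have h5 : ∀ i, ∑ᶠ m, ((H (m - 1) i : R) + H m i) * f m i =
      ∑ᶠ m, (T.meshSum (fun m k => (H m k : R)) m i) * f m i +
        ((if i = j then f 0 i else 0) +
          if i = T.nuPerm j then f (T.nuShift j + 1) i else 0) := by
    intro i
    have e1 : ∑ᶠ m : ℤ, (if m = 0 then if i = j then f m i else 0 else 0) =
        if i = j then f 0 i else 0 := by
      rw [finsum_eq_single _ 0 fun m hm => if_neg hm, if_pos rfl]
    have e2 : ∑ᶠ m : ℤ, (if m = T.nuShift j + 1 then if i = T.nuPerm j then f m i else 0 else 0) =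
        if i = T.nuPerm j then f (T.nuShift j + 1) i else 0 := by
      rw [finsum_eq_single _ (T.nuShift j + 1) fun m hm => if_neg hm, if_pos rfl]
    have fin_single : ∀ (a : ℤ) (g : ℤ → R),
        Function.HasFiniteSupport fun m => if m = a then g m else 0 := fun a g =>
      (Set.finite_singleton a).subset fun m hm => by
        by_contra h
        exact hm (if_neg h)
    have fin_mesh : Function.HasFiniteSupport fun m =>
        T.meshSum (fun m k => (H m k : R)) m i * f m i :=
      (Set.finite_iUnion fun k => hH.finite_support (T.offset k i) k).subset fun m hm => by
        by_contra h
        simp only [Set.mem_iUnion, Set.mem_ofPred_eq, not_exists, not_not] at h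
        exact hm (by simp [meshSum, h])
    have fin_pair : Function.HasFiniteSupport fun m : ℤ =>
        (if m = 0 then if i = j then f m i else 0 else 0) +
          if m = T.nuShift j + 1 then if i = T.nuPerm j then f m i else 0 else 0 :=
      (fin_single _ _).add (fin_single _ _)
    rw [← e1, ← e2, ← finsum_add_distrib (fin_single _ _) (fin_single _ _),
      ← finsum_add_distrib fin_mesh fin_pair]
    refine finsum_congr fun m => ?_
    have := congrArg (Int.cast : ℤ → R) (hH.mesh m i)
    simp only [meshSum, Int.cast_add, Int.cast_sum, Int.cast_ite, Int.cast_one,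
      Int.cast_zero] at this ⊢
    rw [this, add_mul, add_mul, add_assoc]
    simp only [ite_mul, one_mul, zero_mul, ite_and]
  simp only [h5, Finset.sum_add_distrib] at h3
  simpa using h3

end IsHammock

/-- Tropical friezes on the standard repetition quiver. -/
def IsTropicalFrieze (e : ℤ → Fin T.rank → ℤ) : Prop :=
  ∀ m i, e (m - 1) i + e m i = min 0 (T.meshSum e m i)

theorem IsTropicalFrieze.isAddKnit {e : ℤ → Fin T.rank → ℤ} (he : IsTropicalFrieze e)
    (s : Fin T.rank → ℤ) : IsAddKnit (fun h a => min 0 h - a) s e :=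
  ⟨fun m i _ => by linarith [he m i], fun m i _ => by linarith [he m i]⟩

theorem exists_isTropicalFrieze (x : Fin T.rank → ℤ) :
    ∃ e : ℤ → Fin T.rank → ℤ, IsTropicalFrieze e ∧ ∀ i, e 0 i = x i := by
  obtain ⟨e, he, hx⟩ := exists_isAddKnit (fun h a => min 0 h - a) (isSlice_const (T := T) 0) x
  refine ⟨e, fun m i => ?_, hx⟩
  rcases lt_or_ge 0 m with h | h
  · linarith [he.1 m i h]
  · linarith [he.2 m i h]

theorem IsTropicalFrieze.eq_hammock {j : Fin T.rank} {H e : ℤ → Fin T.rank → ℤ}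
    (hH : T.IsHammock j H) (he : IsTropicalFrieze e) (h0 : ∀ i, e 0 i = if i = j then 1 else 0)
    (m : ℤ) (i : Fin T.rank) : 0 ≤ m → m ≤ T.nuShift (T.nuPerm i) + 2 →
      e m i = - H (m - 1) i + (if m = 0 ∧ i = j then 1 else 0) +
        if m = T.nuShift j + 2 ∧ i = T.nuPerm j then 1 else 0 := by
  have hs := T.nuShift_nonneg
  have hneg : ∀ m i, m < 0 → H m i = 0 := fun m i hm => by
    by_contra h
    exact absurd (hH.support m i h).1 (by omega)
  have hlarge : ∀ m i, T.nuShift (T.nuPerm i) < m → H m i = 0 := fun m i hm => by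
    by_contra h
    exact absurd (hH.support m i h).2 (by omega)
  revert m i
  refine knit_induction (isSlice_const 0) ?_ ?_ ?_
  · intro i _ _
    have := hs j
    rw [h0, hneg _ _ (by norm_num), if_neg (by omega : ¬ ((0 : ℤ) = T.nuShift j + 2 ∧ _))]
    simp
  · intro m i hm h1 h2 _ hmi
    have h1' := h1 (by omega) (by omega)
    have hmesh : T.meshSum e m i = - T.meshSum H (m - 1) i +
        (if T.Adj j i ∧ m + T.offset j i = 0 then 1 else 0) +
        if T.Adj (T.nuPerm j) i ∧ m + T.offset (T.nuPerm j) i = T.nuShift j + 2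
          then 1 else 0 := by
      have : ∀ k ∈ T.nbrs i, e (m + T.offset k i) k = - H (m - 1 + T.offset k i) k +
          (if j = k then (if m + T.offset j i = 0 then 1 else 0) else 0) +
          if T.nuPerm j = k then
            (if m + T.offset (T.nuPerm j) i = T.nuShift j + 2 then 1 else 0) else 0 := by
        intro k hk
        have hk' := (T.mem_nbrs).1 hk
        have e1 := T.nuShift_add_offset (T.adj_nuPerm hk')
        rw [T.nuPerm_nuPerm, T.nuPerm_nuPerm] at e1
        have e2 := offset_le k i
        have e3 := offset_le (T.nuPerm k) (T.nuPerm i)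
        rw [h2 k hk (by omega) (by omega), add_sub_right_comm]
        congr 1
        · congr 1
          by_cases h : j = k
          · subst h; simp
          · simp [h, Ne.symm h]
        · by_cases h : T.nuPerm j = k
          · subst h; simp
          · simp [h, Ne.symm h]
      rw [meshSum, Finset.sum_congr rfl this, Finset.sum_add_distrib, Finset.sum_add_distrib,
        Finset.sum_neg_distrib, Finset.sum_ite_eq, Finset.sum_ite_eq]
      simp only [mem_nbrs, ite_and]
      rfl
    have hS : 0 ≤ T.meshSum H (m - 1) i := Finset.sum_nonneg fun k _ => hH.nonneg _ _
    have hHm := hH.mesh (m - 1) i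
    have h0S : T.Adj j i → m + T.offset j i = 0 → T.meshSum H (m - 1) i = 0 := by
      intro ha h
      have hij : T.StdArrow i j := by
        refine ha.resolve_left fun h' => ?_
        simp only [offset, h', if_true] at h
        omega
      have := hs j
      have e1 : m = 1 := by
        simp only [offset, hij.asymm, if_false] at h
        omega
      subst e1
      rw [hneg _ _ (by norm_num), sub_self, hH.first i hij, if_neg (fun h => ha.ne h.2.symm),
        if_neg (by omega)] at hHm
      simpa using hHm.symm
    have h1S : T.Adj (T.nuPerm j) i → m + T.offset (T.nuPerm j) i = T.nuShift j + 2 →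
        T.meshSum H (m - 1) i = 0 := by
      intro ha h
      have ha' := adj_nuPerm_comm.1 ha
      have e1 := T.nuShift_add_offset ha'
      rw [T.nuPerm_nuPerm] at e1
      have e2 := offset_le j (T.nuPerm i)
      have hji : T.StdArrow j (T.nuPerm i) := by
        by_contra h'
        have : T.offset j (T.nuPerm i) = -1 := by simp [offset, h']
        omega
      have e3 : T.offset j (T.nuPerm i) = 0 := by simp [offset, hji]
      have e4 := hH.last _ hji
      rw [T.nuPerm_nuPerm] at e4
      have := hs (T.nuPerm i)
      rw [hlarge (m - 1) i (by omega), show m - 1 - 1 = T.nuShift (T.nuPerm i) by omega, e4,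
        if_neg (by omega), if_neg (fun h => ha.ne h.2.symm)] at hHm
      simpa using hHm.symm
    have key : min 0 (T.meshSum e m i) = - T.meshSum H (m - 1) i := by
      rw [hmesh]
      split_ifs with c1 c2 c2
      · rw [h0S c1.1 c1.2]; norm_num
      · rw [h0S c1.1 c1.2]; norm_num
      · rw [h1S c2.1 c2.2]; norm_num
      · simpa using hS
    have e1 : ¬ (m - 1 = T.nuShift j + 2 ∧ i = T.nuPerm j) := by
      rintro ⟨h, rfl⟩
      rw [T.nuPerm_nuPerm] at hmi
      omega
    have e2 : ¬ (m = 0 ∧ i = j) := by omega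
    have e3 : (m = T.nuShift j + 2 ∧ i = T.nuPerm j) ↔
        (m - 1 = T.nuShift j + 1 ∧ i = T.nuPerm j) := by omega
    have := he m i
    rw [if_neg e1] at h1'
    simp only [if_neg e2, e3]
    linarith
  · intro m i hm _ _ h
    omega

theorem IsTropicalFrieze.twist_eq {e : ℤ → Fin T.rank → ℤ} {j : Fin T.rank}
    (he : IsTropicalFrieze e) (h0 : ∀ i, e 0 i = if i = j then 1 else 0) : twist 2 e = e := by
  have ht : IsTropicalFrieze (twist 2 e) := fun m i => by
    rw [meshSum_twist, ← he]
    simp only [twist]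
    congr 2
    ring
  refine IsAddKnit.unique (isSlice_const 0) (ht.isAddKnit _) (he.isAddKnit _) fun i => ?_
  obtain ⟨H, hH⟩ := T.exists_isHammock j
  have := T.nuShift_nonneg i
  rw [twist, zero_add, he.eq_hammock hH h0 _ _ (by omega) (by rw [T.nuPerm_nuPerm]), h0]
  have e1 : H (T.nuShift i + 2 - 1) (T.nuPerm i) = 0 := by
    by_contra h
    have := (hH.support _ _ h).2
    rw [T.nuPerm_nuPerm] at this
    omega
  have e2 : (T.nuShift i + 2 = T.nuShift j + 2 ∧ T.nuPerm i = T.nuPerm j) ↔ i = j :=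
    ⟨fun h => by rw [← T.nuPerm_nuPerm i, h.2, T.nuPerm_nuPerm], fun h => by simp [h]⟩
  rw [e1, if_neg (by omega)]
  simp only [e2]
  simp

end DynkinType

section Order

variable {P K : Type*} [CommRing P] [Field K] [Algebra P K]

/-- `z` is `t ^ e` times a fraction whose numerator and denominator are positive under `ev`. -/
def HasOrder (ev : P →+* ℚ) (t : P) (e : ℤ) (z : K) : Prop :=
  ∃ p q : P, 0 < ev p ∧ 0 < ev q ∧
    z * algebraMap P K q = algebraMap P K t ^ e * algebraMap P K p

theorem algebraMap_ne_zero_of_pos [FaithfulSMul P K] {ev : P →+* ℚ} {p : P} (hp : 0 < ev p) :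
    algebraMap P K p ≠ 0 := by
  rw [Ne, FaithfulSMul.algebraMap_eq_zero_iff]
  rintro rfl
  simp at hp

namespace HasOrder

variable {ev : P →+* ℚ} {t : P} {e e' : ℤ} {z z' : K}

theorem one : HasOrder ev t 0 (1 : K) := ⟨1, 1, by simp, by simp, by simp⟩

theorem of_pos {p : P} (hp : 0 < ev p) : HasOrder ev t 0 (algebraMap P K p) :=
  ⟨p, 1, hp, by simp, by simp⟩

theorem self : HasOrder ev t 1 (algebraMap P K t) := ⟨1, 1, by simp, by simp, by simp⟩

variable [FaithfulSMul P K]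

theorem ne_zero (ht : t ≠ 0) (h : HasOrder ev t e z) : z ≠ 0 := by
  rintro rfl
  obtain ⟨p, q, hp, hq, h⟩ := h
  have ht' : algebraMap P K t ≠ 0 := by rwa [Ne, FaithfulSMul.algebraMap_eq_zero_iff]
  rw [zero_mul, eq_comm] at h
  exact mul_ne_zero (zpow_ne_zero _ ht') (algebraMap_ne_zero_of_pos hp) h

theorem mul (ht : t ≠ 0) (h : HasOrder ev t e z) (h' : HasOrder ev t e' z') :
    HasOrder ev t (e + e') (z * z') := by
  have ht' : algebraMap P K t ≠ 0 := by rwa [Ne, FaithfulSMul.algebraMap_eq_zero_iff]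
  obtain ⟨p, q, hp, hq, h⟩ := h
  obtain ⟨p', q', hp', hq', h'⟩ := h'
  refine ⟨p * p', q * q', by rw [map_mul]; positivity, by rw [map_mul]; positivity, ?_⟩
  rw [map_mul, map_mul, zpow_add₀ ht']
  linear_combination (z' * algebraMap P K q') * h +
    (algebraMap P K t ^ e * algebraMap P K p) * h'

theorem inv (ht : t ≠ 0) (h : HasOrder ev t e z) : HasOrder ev t (-e) z⁻¹ := by
  have hz := h.ne_zero ht
  have ht' : algebraMap P K t ≠ 0 := by rwa [Ne, FaithfulSMul.algebraMap_eq_zero_iff]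
  obtain ⟨p, q, hp, hq, h⟩ := h
  refine ⟨q, p, hq, hp, ?_⟩
  rw [zpow_neg]
  have := zpow_ne_zero e ht'
  field_simp
  linear_combination -h

theorem prod (ht : t ≠ 0) {ι : Type*} {s : Finset ι} {e : ι → ℤ} {z : ι → K}
    (h : ∀ k ∈ s, HasOrder ev t (e k) (z k)) :
    HasOrder ev t (∑ k ∈ s, e k) (∏ k ∈ s, z k) := by
  classical
  induction s using Finset.induction_on with
  | empty => simpa using one
  | insert a s ha ih =>
    rw [Finset.sum_insert ha, Finset.prod_insert ha]
    exact (h a (Finset.mem_insert_self a s)).mul ht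
      (ih fun k hk => h k (Finset.mem_insert_of_mem hk))

theorem one_add (ht : t ≠ 0) (hev : 0 ≤ ev t) (h : HasOrder ev t e z) :
    HasOrder ev t (min 0 e) (1 + z) := by
  have ht' : algebraMap P K t ≠ 0 := by rwa [Ne, FaithfulSMul.algebraMap_eq_zero_iff]
  obtain ⟨p, q, hp, hq, h⟩ := h
  obtain ⟨n, rfl | rfl⟩ := e.eq_nat_or_neg
  · refine ⟨q + t ^ n * p, q, by simp only [map_add, map_mul, map_pow]; positivity, hq, ?_⟩
    rw [min_eq_left (by positivity), zpow_zero]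
    simp only [map_add, map_mul, map_pow]
    rw [zpow_natCast] at h
    linear_combination h
  · refine ⟨t ^ n * q + p, q, by simp only [map_add, map_mul, map_pow]; positivity, hq, ?_⟩
    rw [min_eq_right (by simp)]
    simp only [map_add, map_mul, map_pow]
    rw [zpow_neg, zpow_natCast] at *
    have := pow_ne_zero n ht'
    field_simp at h ⊢
    linear_combination h

end HasOrder

end Order

section SpecializesTo

variable {P K₀ K : Type*} [CommRing P] [Field K₀] [Algebra P K₀] [Field K]

/-- The fraction `a` specializes to `b` under `φ`. -/
def SpecializesTo (φ : P →+* K) (a : K₀) (b : K) : Prop :=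
  ∃ p q : P, φ q ≠ 0 ∧ a * algebraMap P K₀ q = algebraMap P K₀ p ∧ b * φ q = φ p

namespace SpecializesTo

variable {φ : P →+* K} {a a' : K₀} {b b' : K}

theorem of_algebraMap (p : P) : SpecializesTo φ (algebraMap P K₀ p) (φ p) :=
  ⟨p, 1, by simp, by simp, by simp⟩

theorem one : SpecializesTo φ (1 : K₀) 1 := ⟨1, 1, by simp, by simp, by simp⟩

theorem mul (h : SpecializesTo φ a b) (h' : SpecializesTo φ a' b') :
    SpecializesTo φ (a * a') (b * b') := by
  obtain ⟨p, q, hq, h1, h2⟩ := h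
  obtain ⟨p', q', hq', h1', h2'⟩ := h'
  refine ⟨p * p', q * q', by rw [map_mul]; exact mul_ne_zero hq hq', ?_, ?_⟩
  · rw [map_mul, map_mul, ← h1, ← h1']; ring
  · rw [map_mul, map_mul, ← h2, ← h2']; ring

theorem one_add (h : SpecializesTo φ a b) : SpecializesTo φ (1 + a) (1 + b) := by
  obtain ⟨p, q, hq, h1, h2⟩ := h
  refine ⟨q + p, q, hq, ?_, ?_⟩
  · rw [map_add, ← h1]; ring
  · rw [map_add, ← h2]; ring

theorem prod {ι : Type*} {s : Finset ι} {a : ι → K₀} {b : ι → K}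
    (h : ∀ k ∈ s, SpecializesTo φ (a k) (b k)) :
    SpecializesTo φ (∏ k ∈ s, a k) (∏ k ∈ s, b k) := by
  classical
  induction s using Finset.induction_on with
  | empty => simpa using one
  | insert c s hc ih =>
    rw [Finset.prod_insert hc, Finset.prod_insert hc]
    exact (h c (Finset.mem_insert_self c s)).mul
      (ih fun k hk => h k (Finset.mem_insert_of_mem hk))

variable [FaithfulSMul P K₀]

theorem inv (h : SpecializesTo φ a b) (hb : b ≠ 0) : SpecializesTo φ a⁻¹ b⁻¹ := by
  obtain ⟨p, q, hq, h1, h2⟩ := h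
  have hp : φ p ≠ 0 := h2 ▸ mul_ne_zero hb hq
  have hp' : algebraMap P K₀ p ≠ 0 := by
    rw [Ne, FaithfulSMul.algebraMap_eq_zero_iff]
    rintro rfl
    exact hp (map_zero φ)
  have ha : a ≠ 0 := by
    rintro rfl
    exact hp' (by rw [← h1, zero_mul])
  refine ⟨q, p, hp, ?_, ?_⟩
  · rw [← h1]; field_simp
  · rw [← h2]; field_simp

theorem unique (h : SpecializesTo φ a b) (h' : SpecializesTo φ a b') : b = b' := by
  obtain ⟨p, q, hq, h1, h2⟩ := h
  obtain ⟨p', q', hq', h1', h2'⟩ := h'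
  have : p * q' = p' * q := FaithfulSMul.algebraMap_injective P K₀ <| by
    rw [map_mul, map_mul, ← h1, ← h1']; ring
  have := congrArg φ this
  rw [map_mul, map_mul, ← h2, ← h2'] at this
  refine mul_right_cancel₀ (mul_ne_zero hq hq') ?_
  linear_combination this

end SpecializesTo

end SpecializesTo

section Laurent

variable {σ P : Type*} [CommRing P] (K : Type*) [Field K] [Algebra P K]

/-- The elements that become integral after multiplication by some of the `x j`. -/
def laurentSubring (x : σ → P) : Subring K where
  carrier := {z | ∃ (s : Multiset σ) (p : P), z * algebraMap P K (s.map x).prod = algebraMap P K p}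
  zero_mem' := ⟨0, 0, by simp⟩
  one_mem' := ⟨0, 1, by simp⟩
  add_mem' := by
    rintro a b ⟨s, p, hp⟩ ⟨t, q, hq⟩
    refine ⟨s + t, p * (t.map x).prod + q * (s.map x).prod, ?_⟩
    simp only [Multiset.map_add, Multiset.prod_add, map_mul, map_add, ← hp, ← hq]
    ring
  mul_mem' := by
    rintro a b ⟨s, p, hp⟩ ⟨t, q, hq⟩
    refine ⟨s + t, p * q, ?_⟩
    simp only [Multiset.map_add, Multiset.prod_add, map_mul, ← hp, ← hq]
    ring
  neg_mem' := by
    rintro a ⟨s, p, hp⟩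
    exact ⟨s, -p, by rw [map_neg, ← hp, neg_mul]⟩

variable {K} {x : σ → P}

theorem algebraMap_mem_laurentSubring (p : P) : algebraMap P K p ∈ laurentSubring K x :=
  ⟨0, p, by simp⟩

theorem mem_laurentSubring_of_mul_mem {z : K} {i : σ}
    (h : algebraMap P K (x i) * z ∈ laurentSubring K x) : z ∈ laurentSubring K x := by
  obtain ⟨s, p, hp⟩ := h
  refine ⟨i ::ₘ s, p, ?_⟩
  rw [← hp, Multiset.map_cons, Multiset.prod_cons, map_mul]
  ring

theorem exists_algebraMap_eq_of_hasOrder [FaithfulSMul P K] {z : K}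
    (hz : z ∈ laurentSubring K x) (hx : ∀ j, Prime (x j)) {ev : σ → P →+* ℚ}
    (hev : ∀ j, ev j (x j) = 0) (h : ∀ j, ∃ e : ℕ, HasOrder (ev j) (x j) e z) :
    ∃ p, z = algebraMap P K p := by
  obtain ⟨s, p, hp⟩ := hz
  induction s using Multiset.induction_on generalizing p with
  | empty => exact ⟨p, by simpa using hp⟩
  | cons a s ih =>
    rw [Multiset.map_cons, Multiset.prod_cons] at hp
    obtain ⟨e, p', q, -, hq, hpq⟩ := h a
    have key : p * q = x a * ((s.map x).prod * x a ^ e * p') :=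
      FaithfulSMul.algebraMap_injective P K <| by
        rw [zpow_natCast] at hpq
        simp only [map_mul, map_pow] at hp hpq ⊢
        rw [← hp]
        linear_combination (algebraMap P K (x a) * algebraMap P K (s.map x).prod) * hpq
    have hdvd : x a ∣ p := ((hx a).dvd_or_dvd ⟨_, key⟩).resolve_right <| by
      rintro ⟨r, rfl⟩
      rw [map_mul, hev, zero_mul] at hq
      exact hq.false
    obtain ⟨r, rfl⟩ := hdvd
    refine ih r (mul_left_cancel₀ (a := algebraMap P K (x a)) ?_ ?_)
    · rw [Ne, FaithfulSMul.algebraMap_eq_zero_iff]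
      exact (hx a).ne_zero
    · rw [← map_mul, ← hp, map_mul]
      ring

end Laurent

theorem Subring.prod_one_add_mul_eq {K ι : Type*} [CommRing K] (R : Subring K) {a : K} (ha : a ∈ R)
    {s : Finset ι} {r : ι → K} (hr : ∀ k ∈ s, r k ∈ R) :
    ∃ ρ ∈ R, ∏ k ∈ s, (1 + a * r k) = 1 + a * ρ := by
  classical
  induction s using Finset.induction_on with
  | empty => exact ⟨0, R.zero_mem, by simp⟩
  | insert c s hc ih =>
    obtain ⟨ρ, hρ, h⟩ := ih fun k hk => hr k (Finset.mem_insert_of_mem hk)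
    have hc' := hr c (Finset.mem_insert_self c s)
    refine ⟨ρ + r c + a * r c * ρ,
      R.add_mem (R.add_mem hρ hc') (R.mul_mem (R.mul_mem ha hc') hρ), ?_⟩
    rw [Finset.prod_insert hc, h]
    ring

/-- The exchange argument behind the Laurent phenomenon. -/
theorem Subring.mem_of_exchange {K ι : Type*} [Field K] (R : Subring K) {a b c : K} {s : Finset ι}
    {y z r : ι → K} (ha0 : a ≠ 0) (ha : a ∈ R) (hb : b ∈ R) (hz : ∀ k ∈ s, z k ∈ R)
    (hr : ∀ k ∈ s, r k ∈ R) (hab : a * b = 1 + ∏ k ∈ s, y k) (hac : a * c = 1 + ∏ k ∈ s, z k)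
    (hyz : ∀ k ∈ s, y k * z k = 1 + a * r k) : c ∈ R := by
  obtain ⟨ρ, hρ, h⟩ := R.prod_one_add_mul_eq ha hr
  rw [← Finset.prod_congr rfl hyz, Finset.prod_mul_distrib] at h
  have : c = b * ∏ k ∈ s, z k - ρ := mul_left_cancel₀ ha0 <| by
    linear_combination hac - h - (∏ k ∈ s, z k) * hab
  rw [this]
  exact R.sub_mem (R.mul_mem hb (R.prod_mem hz)) hρ

namespace DynkinType

variable {T : DynkinType}

/-- Multiplicative friezes on the standard repetition quiver, with values in a field. -/
def IsFrieze {K : Type*} [Field K] (G : ℤ → Fin T.rank → K) : Prop :=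
  ∀ m i, G (m - 1) i * G m i = 1 + T.meshProd G m i

section HasOrder

variable {P K : Type*} [CommRing P] [Field K] [Algebra P K] [FaithfulSMul P K]
  {ev : P →+* ℚ} {t : P} {s : Fin T.rank → ℤ} {G : ℤ → Fin T.rank → K}

theorem hasOrder_of_mesh (ht : t ≠ 0) (hev : 0 ≤ ev t) (hs : T.IsSlice s)
    (hf : ∀ m i, s i < m → G (m - 1) i ≠ 0 → G (m - 1) i * G m i = 1 + T.meshProd G m i)
    (hb : ∀ m i, m ≤ s i → G m i ≠ 0 → G (m - 1) i * G m i = 1 + T.meshProd G m i)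
    {e : ℤ → Fin T.rank → ℤ} (he : IsTropicalFrieze e)
    (h0 : ∀ i, HasOrder ev t (e (s i) i) (G (s i) i)) (m : ℤ) (i : Fin T.rank) :
    HasOrder ev t (e m i) (G m i) := by
  revert m i
  refine knit_induction hs h0 (fun m i hm h1 h2 => ?_) fun m i hm h1 h2 => ?_
  · have hne := h1.ne_zero ht
    have h3 := ((HasOrder.prod ht h2).one_add ht hev).mul ht (h1.inv ht)
    have e1 := he m i
    have e2 : G m i = (1 + T.meshProd G m i) * (G (m - 1) i)⁻¹ := by
      rw [← hf m i hm hne]; field_simp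
    rw [e2, show e m i = min 0 (T.meshSum e m i) + -e (m - 1) i by linarith]
    exact h3
  · have hne := h1.ne_zero ht
    have h3 := ((HasOrder.prod ht h2).one_add ht hev).mul ht (h1.inv ht)
    have e1 := he m i
    have e2 : G (m - 1) i = (1 + T.meshProd G m i) * (G m i)⁻¹ := by
      rw [← hb m i hm hne]; field_simp
    rw [e2, show e (m - 1) i = min 0 (T.meshSum e m i) + -e m i by linarith]
    exact h3

theorem isTropicalFrieze_zero : IsTropicalFrieze fun (_ : ℤ) (_ : Fin T.rank) => (0 : ℤ) :=
  fun m i => by simp [meshSum]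

theorem IsFrieze.ne_zero (hG : IsFrieze G) (hs : T.IsSlice s)
    (h0 : ∀ i, HasOrder ev (1 : P) 0 (G (s i) i)) (m : ℤ) (i : Fin T.rank) : G m i ≠ 0 :=
  have : Nontrivial P := ev.domain_nontrivial
  (hasOrder_of_mesh (ev := ev) one_ne_zero (by simp) hs (fun m i _ _ => hG m i)
    (fun m i _ _ => hG m i) isTropicalFrieze_zero h0 m i).ne_zero one_ne_zero

theorem exists_isFrieze (hs : T.IsSlice s) {x : Fin T.rank → K}
    (hx : ∀ i, HasOrder ev (1 : P) 0 (x i)) :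
    ∃ G : ℤ → Fin T.rank → K, IsFrieze G ∧ ∀ i, G (s i) i = x i := by
  have : Nontrivial P := ev.domain_nontrivial
  obtain ⟨G, hG, h0⟩ := exists_isKnit (fun h a => (1 + h) / a) hs x
  have hf : ∀ m i, s i < m → G (m - 1) i ≠ 0 →
      G (m - 1) i * G m i = 1 + T.meshProd G m i := fun m i hm hne => by
    rw [hG.1 m i hm]; field_simp
  have hb : ∀ m i, m ≤ s i → G m i ≠ 0 →
      G (m - 1) i * G m i = 1 + T.meshProd G m i := fun m i hm hne => by
    rw [hG.2 m i hm]; field_simp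
  have hne : ∀ m i, G m i ≠ 0 := fun m i =>
    (hasOrder_of_mesh (ev := ev) one_ne_zero (by simp) hs hf hb isTropicalFrieze_zero
      (fun i => by rw [h0]; exact hx i) m i).ne_zero one_ne_zero
  refine ⟨G, fun m i => ?_, h0⟩
  rcases lt_or_ge (s i) m with h | h
  · exact hf m i h (hne _ _)
  · exact hb m i h (hne _ _)

end HasOrder

section Field

variable {K : Type*} [Field K] {G g : ℤ → Fin T.rank → K}

theorem IsFrieze.isKnit (hG : IsFrieze G) (hne : ∀ m i, G m i ≠ 0) (s : Fin T.rank → ℤ) :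
    IsKnit (fun h a => (1 + h) / a) s G :=
  ⟨fun m i _ => by rw [eq_div_iff (hne _ _), ← hG, mul_comm],
    fun m i _ => by rw [eq_div_iff (hne _ _), ← hG]⟩

theorem IsFrieze.unique {s : Fin T.rank → ℤ} (hs : T.IsSlice s) (hG : IsFrieze G)
    (hG0 : ∀ m i, G m i ≠ 0) (hg : IsFrieze g) (hg0 : ∀ m i, g m i ≠ 0)
    (h : ∀ i, G (s i) i = g (s i) i) : G = g :=
  (hG.isKnit hG0 s).unique hs (hg.isKnit hg0 s) h

theorem IsFrieze.comp_twist (hG : IsFrieze G) (c : ℤ) : IsFrieze (twist c G) := fun m i => by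
  rw [meshProd_twist, ← hG]
  simp only [twist]
  congr 2
  ring

theorem IsFrieze.specializesTo {P K₀ : Type*} [CommRing P] [Field K₀] [Algebra P K₀]
    [FaithfulSMul P K₀] {φ : P →+* K} {F : ℤ → Fin T.rank → K₀} (hF : IsFrieze F)
    (hF0 : ∀ m i, F m i ≠ 0) (hG : IsFrieze G) (hG0 : ∀ m i, G m i ≠ 0)
    (h : ∀ i, SpecializesTo φ (F 0 i) (G 0 i)) (m : ℤ) (i : Fin T.rank) :
    SpecializesTo φ (F m i) (G m i) := by
  have hF' := hF.isKnit hF0 fun _ => 0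
  have hG' := hG.isKnit hG0 fun _ => 0
  revert m i
  refine knit_induction (isSlice_const 0) h (fun m i hm h1 h2 => ?_) fun m i hm h1 h2 => ?_
  · rw [hF'.1 m i hm, hG'.1 m i hm]
    simp only [div_eq_mul_inv]
    exact (SpecializesTo.prod h2).one_add.mul (h1.inv (hG0 _ _))
  · rw [hF'.2 m i hm, hG'.2 m i hm]
    simp only [div_eq_mul_inv]
    exact (SpecializesTo.prod h2).one_add.mul (h1.inv (hG0 _ _))

theorem IsFrieze.mul_succ (hG : IsFrieze G) (m : ℤ) (i : Fin T.rank) :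
    G m i * G (m + 1) i = 1 + T.meshProd G (m + 1) i := by
  rw [← hG, add_sub_cancel_right]

/-- The other factors of the mesh product at a neighbour `k` of `i` that has `G m i` as a factor. -/
theorem meshProd_nbr {k i : Fin T.rank} (hk : T.Adj k i) (m : ℤ) :
    T.meshProd G (m + 1 + T.offset k i) k =
      G m i * ∏ l ∈ (T.nbrs k).erase i, G (m + 1 + T.offset k i + T.offset l k) l := by
  rw [meshProd, ← Finset.mul_prod_erase _ _ ((T.mem_nbrs).2 hk.symm)]
  congr 2
  linarith [offset_add_offset hk]

theorem IsFrieze.mem_succ (hG : IsFrieze G) (hG0 : ∀ m i, G m i ≠ 0) (R : Subring K) {m : ℤ}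
    (h0 : ∀ i, G (m - 1) i ∈ R) (h1 : ∀ i, G m i ∈ R) (i : Fin T.rank) : G (m + 1) i ∈ R := by
  induction i using WellFoundedLT.induction with
  | _ i ih =>
  have hk : ∀ k ∈ T.nbrs i, G (m + 1 + T.offset k i) k ∈ R := by
    intro k hk
    rw [mem_nbrs] at hk
    rcases hk with h | h
    · simpa [offset, h] using ih k h.lt
    · simpa [offset, h.asymm] using h1 k
  refine R.mem_of_exchange (hG0 m i) (h1 i) (h0 i) hk ?_ ((mul_comm _ _).trans (hG m i))
    (hG.mul_succ m i)
    (r := fun k => ∏ l ∈ (T.nbrs k).erase i, G (m + 1 + T.offset k i + T.offset l k) l) ?_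
  · intro k hk
    rw [mem_nbrs] at hk
    refine R.prod_mem fun l hl => ?_
    have hl' := (T.mem_nbrs).1 (Finset.mem_of_mem_erase hl)
    rcases hk with h | h <;> rcases hl' with h' | h'
    · simpa [offset, h, h'] using ih l (h'.lt.trans h.lt)
    · simpa [offset, h, h'.asymm] using h1 l
    · simpa [offset, h.asymm, h'] using h1 l
    · simpa [offset, h.asymm, h'.asymm, sub_eq_add_neg] using h0 l
  · intro k hk
    rw [← meshProd_nbr ((T.mem_nbrs).1 hk), ← hG]
    congr 2
    ring

theorem IsFrieze.mem_pred (hG : IsFrieze G) (hG0 : ∀ m i, G m i ≠ 0) (R : Subring K) {m : ℤ}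
    (h0 : ∀ i, G (m + 1) i ∈ R) (h1 : ∀ i, G m i ∈ R) (i : Fin T.rank) : G (m - 1) i ∈ R := by
  induction i using WellFoundedGT.induction with
  | _ i ih =>
  have hk : ∀ k ∈ T.nbrs i, G (m + T.offset k i) k ∈ R := by
    intro k hk
    rw [mem_nbrs] at hk
    rcases hk with h | h
    · simpa [offset, h] using h1 k
    · simpa [offset, h.asymm, sub_eq_add_neg] using ih k h.lt
  refine R.mem_of_exchange (hG0 m i) (h1 i) (h0 i) hk ?_ (hG.mul_succ m i)
    ((mul_comm _ _).trans (hG m i))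
    (r := fun k => ∏ l ∈ (T.nbrs k).erase i, G (m + 1 + T.offset k i + T.offset l k) l) ?_
  · intro k hk
    rw [mem_nbrs] at hk
    refine R.prod_mem fun l hl => ?_
    have hl' := (T.mem_nbrs).1 (Finset.mem_of_mem_erase hl)
    rcases hk with h | h <;> rcases hl' with h' | h'
    · simpa [offset, h, h'] using h0 l
    · simpa [offset, h, h'.asymm] using h1 l
    · simpa [offset, h.asymm, h'] using h1 l
    · simpa [offset, h.asymm, h'.asymm, sub_eq_add_neg] using ih l (h.lt.trans h'.lt)
  · intro k hk
    rw [← meshProd_nbr ((T.mem_nbrs).1 hk), ← hG, mul_comm]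
    congr 2
    ring

/-- Two consecutive levels of a frieze generate all its values. -/
theorem IsFrieze.mem_of_levels (hG : IsFrieze G) (hG0 : ∀ m i, G m i ≠ 0) (R : Subring K)
    (h0 : ∀ i, G 0 i ∈ R) (h1 : ∀ i, G 1 i ∈ R) (m : ℤ) (i : Fin T.rank) : G m i ∈ R := by
  have key : ∀ m : ℤ, (∀ i, G m i ∈ R) ∧ ∀ i, G (m + 1) i ∈ R := by
    intro m
    induction m using Int.induction_on with
    | zero => exact ⟨h0, h1⟩
    | succ m ih =>
      exact ⟨ih.2, hG.mem_succ hG0 R (by simpa using ih.1) ih.2⟩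
    | pred m ih =>
      exact ⟨hG.mem_pred hG0 R ih.2 ih.1, by simpa using ih.1⟩
  exact (key m).1 i

theorem IsFrieze.mem_laurentSubring {P : Type*} [CommRing P] [Algebra P K] {x : Fin T.rank → P}
    (hG : IsFrieze G) (hG0 : ∀ m i, G m i ≠ 0) (h0 : ∀ i, G 0 i = algebraMap P K (x i)) (m : ℤ)
    (i : Fin T.rank) : G m i ∈ laurentSubring K x := by
  have h0' : ∀ i, G 0 i ∈ laurentSubring K x := fun i => by
    rw [h0]; exact algebraMap_mem_laurentSubring _
  refine hG.mem_of_levels hG0 _ h0' (fun i => ?_) m i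
  induction i using WellFoundedLT.induction with
  | _ i ih =>
  refine mem_laurentSubring_of_mul_mem (i := i) ?_
  have := hG 1 i
  rw [sub_self, h0] at this
  rw [this]
  refine Subring.add_mem _ (Subring.one_mem _) (Subring.prod_mem _ fun k hk => ?_)
  rw [mem_nbrs] at hk
  rcases hk with h | h
  · simpa [offset, h] using ih k h.lt
  · simpa [offset, h.asymm] using h0' k

end Field

section Generic

open MvPolynomial

variable {K : Type*} [Field K] [Algebra (MvPolynomial (Fin T.rank) ℤ) K]
  [FaithfulSMul (MvPolynomial (Fin T.rank) ℤ) K] {G : ℤ → Fin T.rank → K}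

/-- Evaluation of all indeterminates at `1`. -/
noncomputable def evalOne (σ R : Type*) [CommRing R] [Algebra R ℚ] : MvPolynomial σ R →+* ℚ :=
  (aeval fun _ => 1 : MvPolynomial σ R →ₐ[R] ℚ).toRingHom

theorem evalOne_X_pos {σ R : Type*} [CommRing R] [Algebra R ℚ] (i : σ) :
    0 < evalOne σ R (X i) := by
  simp [evalOne]

/-- Evaluation of the indeterminate `j` at `0` and of all others at `1`. -/
noncomputable def evalExcept {σ : Type*} [DecidableEq σ] (j : σ) : MvPolynomial σ ℤ →+* ℚ :=
  (aeval fun i => if i = j then 0 else 1 : MvPolynomial σ ℤ →ₐ[ℤ] ℚ).toRingHom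

theorem evalExcept_X {σ : Type*} [DecidableEq σ] (j i : σ) :
    evalExcept j (X i) = if i = j then 0 else 1 := by
  simp [evalExcept]

theorem IsFrieze.generic_ne_zero (hG : IsFrieze G)
    (h0 : ∀ i, G 0 i = algebraMap (MvPolynomial (Fin T.rank) ℤ) K (X i)) (m : ℤ)
    (i : Fin T.rank) : G m i ≠ 0 :=
  hG.ne_zero (ev := evalOne (Fin T.rank) ℤ) (isSlice_const 0)
    (fun i => by rw [h0]; exact .of_pos (evalOne_X_pos i)) m i

theorem IsFrieze.generic_hasOrder (hG : IsFrieze G)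
    (h0 : ∀ i, G 0 i = algebraMap (MvPolynomial (Fin T.rank) ℤ) K (X i)) (i j : Fin T.rank)
    (m : ℤ) (hm : m = 2 + T.nuShift i ∨ m = -2 - T.nuShift (T.nuPerm i)) :
    HasOrder (evalExcept j) (X j) ((if i = j then 1 else 0 : ℕ) : ℤ) (G m (T.nuPerm i)) := by
  obtain ⟨e, he, he0⟩ := exists_isTropicalFrieze (T := T) fun i => if i = j then 1 else 0
  have key : e m (T.nuPerm i) = ((if i = j then 1 else 0 : ℕ) : ℤ) := by
    have h1 := he.twist_eq he0
    push_cast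
    rw [← he0]
    rcases hm with rfl | rfl
    · conv_rhs => rw [← h1]
      rw [twist]
      congr 1
      ring
    · conv_lhs => rw [← h1]
      rw [twist, T.nuPerm_nuPerm]
      congr 1
      ring
  rw [← key]
  refine hasOrder_of_mesh (X_ne_zero j) (by simp [evalExcept_X]) (isSlice_const 0)
    (fun m i _ _ => hG m i) (fun m i _ _ => hG m i) he (fun i => ?_) m _
  rw [he0, h0]
  split_ifs with h
  · subst h; exact .self
  · exact .of_pos (by simp [evalExcept_X, h])

theorem IsFrieze.generic_exists_eq_mul (hG : IsFrieze G)
    (h0 : ∀ i, G 0 i = algebraMap (MvPolynomial (Fin T.rank) ℤ) K (X i)) (i : Fin T.rank)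
    (m : ℤ) (hm : m = 2 + T.nuShift i ∨ m = -2 - T.nuShift (T.nuPerm i)) :
    ∃ p : MvPolynomial (Fin T.rank) ℤ, G m (T.nuPerm i) = algebraMap _ K (X i * p) := by
  obtain ⟨p, hp⟩ := exists_algebraMap_eq_of_hasOrder
    (hG.mem_laurentSubring (hG.generic_ne_zero h0) h0 m (T.nuPerm i)) (fun j => X_prime)
    (ev := evalExcept) (fun j => by simp [evalExcept_X])
    fun j => ⟨_, hG.generic_hasOrder h0 i j m hm⟩
  obtain ⟨r, q, -, hq, h⟩ := hG.generic_hasOrder h0 i i m hm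
  rw [hp, if_pos rfl, Nat.cast_one, zpow_one, ← map_mul, ← map_mul] at h
  have h' := FaithfulSMul.algebraMap_injective _ K h
  obtain ⟨c, rfl⟩ : X i ∣ p := (X_prime.dvd_or_dvd ⟨r, h'⟩).resolve_right <| by
    rintro ⟨c, rfl⟩
    rw [map_mul, evalExcept_X, if_pos rfl, zero_mul] at hq
    exact hq.false
  exact ⟨c, hp⟩

theorem IsFrieze.generic_apply (hG : IsFrieze G)
    (h0 : ∀ i, G 0 i = algebraMap (MvPolynomial (Fin T.rank) ℤ) K (X i)) (i : Fin T.rank) :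
    G (2 + T.nuShift i) (T.nuPerm i) = algebraMap (MvPolynomial (Fin T.rank) ℤ) K (X i) := by
  have hG0 := hG.generic_ne_zero h0
  choose N hN using fun i => hG.generic_exists_eq_mul h0 i _ (.inl rfl)
  choose M hM using fun i => hG.generic_exists_eq_mul h0 i _ (.inr rfl)
  let ψ : MvPolynomial (Fin T.rank) ℤ →+* MvPolynomial (Fin T.rank) ℤ :=
    (aeval fun i => X i * N i : MvPolynomial (Fin T.rank) ℤ →ₐ[ℤ] _).toRingHom
  have hψ : ∀ i, ψ (X i) = X i * N i := fun i => by simp [ψ]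
  have hunit : IsUnit (N i) := by
    have h1 := hG.specializesTo (φ := (algebraMap _ K).comp ψ) hG0 (hG.comp_twist 2)
      (fun m i => hG0 _ _) (fun k => ?_) (-2 - T.nuShift (T.nuPerm i)) (T.nuPerm i)
    · rw [hM, twist, T.nuPerm_nuPerm, show -2 - T.nuShift (T.nuPerm i) + T.nuShift (T.nuPerm i) + 2
        = 0 by ring, h0] at h1
      have h2 := h1.unique (.of_algebraMap _)
      rw [RingHom.comp_apply] at h2
      have h3 := FaithfulSMul.algebraMap_injective _ K h2
      rw [map_mul, hψ, mul_assoc] at h3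
      exact IsUnit.of_mul_eq_one _ (mul_left_cancel₀ (X_ne_zero i) (by rw [← h3, mul_one]))
    · rw [h0, twist, zero_add, add_comm, hN, ← hψ]
      exact .of_algebraMap (φ := (algebraMap _ K).comp ψ) _
  obtain ⟨c, hc, hNc⟩ := MvPolynomial.isUnit_iff_eq_C_of_isReduced.1 hunit
  obtain ⟨r, q, hr, hq, h⟩ := hG.generic_hasOrder h0 i i _ (.inl rfl)
  rw [hN, if_pos rfl, Nat.cast_one, zpow_one, ← map_mul, ← map_mul, mul_assoc] at h
  have h' := congrArg (evalExcept i)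
    (mul_left_cancel₀ (X_ne_zero i) (FaithfulSMul.algebraMap_injective _ K h))
  rw [map_mul, hNc] at h'
  have hc' : evalExcept i (C c) = c := by simp [evalExcept]
  rw [hc'] at h'
  have hpos : 0 < c := by
    have : (0 : ℚ) < c := pos_of_mul_pos_left (h' ▸ hr) hq.le
    exact_mod_cast this
  rcases Int.isUnit_iff.1 hc with rfl | rfl
  · rw [hN, hNc]; simp
  · omega

end Generic

/-- Multiplicative friezes without zeros are periodic. -/
theorem IsFrieze.twist_eq {K : Type*} [Field K] {g : ℤ → Fin T.rank → K} (hg : IsFrieze g)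
    (hg0 : ∀ m i, g m i ≠ 0) : twist 2 g = g := by
  let P := MvPolynomial (Fin T.rank) ℤ
  obtain ⟨G, hG, h0⟩ := exists_isFrieze (K := FractionRing P) (P := P)
    (ev := evalOne (Fin T.rank) ℤ) (isSlice_const (T := T) 0)
    (x := fun i => algebraMap P _ (MvPolynomial.X i)) fun i => .of_pos (evalOne_X_pos i)
  have hG0 := hG.generic_ne_zero h0
  refine (hg.comp_twist 2).unique (isSlice_const 0) (fun _ _ => hg0 _ _) hg hg0 fun i => ?_
  have hsp := hG.specializesTo (φ := (MvPolynomial.aeval (g 0) : P →ₐ[ℤ] K).toRingHom) hG0 hg hg0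
    fun i => by
      rw [h0]
      convert SpecializesTo.of_algebraMap _
      simp
  have h1 := hsp (2 + T.nuShift i) (T.nuPerm i)
  rw [hG.generic_apply h0, ← h0] at h1
  rw [twist, zero_add, add_comm]
  exact h1.unique (hsp 0 i)

end DynkinType

namespace DynkinLabelling

open DynkinType

variable {T : DynkinType} {V : Type u} [Quiver.{v} V] (L : DynkinLabelling T V)

theorem reversals_of_stdArrow {i j : Fin T.rank} (h : T.StdArrow i j) :
    (Nonempty (L.label.symm j ⟶ L.label.symm i) ∧ L.reversals j = L.reversals i + 1) ∨
      (IsEmpty (L.label.symm j ⟶ L.label.symm i) ∧ L.reversals j = L.reversals i) := by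
  obtain ⟨h0, h1⟩ := h
  obtain rfl : i = ⟨T.prev j.val, (T.prev_lt h0).trans j.isLt⟩ := Fin.ext h1
  rw [reversals, dif_pos h0]
  split_ifs with h2
  · exact .inl ⟨h2, rfl⟩
  · exact .inr ⟨not_nonempty_iff.1 h2, add_zero _⟩

theorem isSlice_neg_reversals : T.IsSlice fun i => -L.reversals i := fun i j h => by
  have := L.reversals_of_stdArrow h
  constructor <;> dsimp only <;> omega

theorem unique_arrow {t w : V} (h : T.Adj (L.label t) (L.label w)) :
    ∃ a : (t ⟶ w) ⊕ (w ⟶ t), ∀ b, b = a := by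
  have h1 := L.card_arrows t w h
  rw [← ENat.card_sum] at h1
  obtain ⟨h2⟩ := ENat.card_eq_one_iff_unique.1 h1
  exact ⟨default, fun b => Subsingleton.elim _ _⟩

theorem adj_of_hom {t w : V} (a : t ⟶ w) : T.Adj (L.label t) (L.label w) := by
  by_contra h
  exact (L.isEmpty_arrows _ _ h).false a

/-- An arrow of the repetition quiver is an arrow of the standard repetition quiver. -/
theorem toStandard_of_hom {w x : RepetitionQuiver V} (a : w ⟶ x) :
    T.Adj (L.label w.vertex) (L.label x.vertex) ∧
      L.toStandard w = ((L.toStandard x).1 + T.offset (L.label w.vertex) (L.label x.vertex),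
        L.label w.vertex) := by
  obtain ⟨l, t⟩ := w
  obtain ⟨l', u⟩ := x
  have main : ∀ (d : ℤ), T.Adj (L.label t) (L.label u) → l' = l + d →
      (d = 0 ∧ Nonempty (t ⟶ u) ∨ d = 1 ∧ Nonempty (u ⟶ t)) →
      l - L.reversals (L.label t) =
        l' - L.reversals (L.label u) + T.offset (L.label t) (L.label u) := by
    intro d hadj hd h
    obtain ⟨a, ha⟩ := L.unique_arrow hadj
    have excl : ∀ (b : t ⟶ u) (c : u ⟶ t), False := fun b c => by
      have := (ha (.inl b)).trans (ha (.inr c)).symm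
      simp at this
    rcases hadj with hs | hs
    · have h1 := L.reversals_of_stdArrow hs
      simp only [Equiv.symm_apply_apply] at h1
      simp only [offset, hs, if_true]
      rcases h with ⟨rfl, ⟨b⟩⟩ | ⟨rfl, ⟨b⟩⟩
      · rcases h1 with ⟨⟨c⟩, -⟩ | ⟨-, h1⟩
        · exact (excl b c).elim
        · linarith
      · rcases h1 with ⟨-, h1⟩ | ⟨h1, -⟩
        · linarith
        · exact (h1.false b).elim
    · have h1 := L.reversals_of_stdArrow hs
      simp only [Equiv.symm_apply_apply] at h1
      simp only [offset, hs.asymm, if_false]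
      rcases h with ⟨rfl, ⟨b⟩⟩ | ⟨rfl, ⟨b⟩⟩
      · rcases h1 with ⟨-, h1⟩ | ⟨h1, -⟩
        · linarith
        · exact (h1.false b).elim
      · rcases h1 with ⟨⟨c⟩, -⟩ | ⟨-, h1⟩
        · exact (excl c b).elim
        · linarith
  rcases a with ⟨b, hb⟩ | ⟨b, hb⟩
  · have hadj := L.adj_of_hom b
    exact ⟨hadj, Prod.ext (main 0 hadj (by simpa using hb) (.inl ⟨rfl, ⟨b⟩⟩)) rfl⟩
  · have hadj := (L.adj_of_hom b).symm
    exact ⟨hadj, Prod.ext (main 1 hadj hb (.inr ⟨rfl, ⟨b⟩⟩)) rfl⟩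

theorem exists_hom (x : RepetitionQuiver V) {k : Fin T.rank} (hk : T.Adj k (L.label x.vertex)) :
    ∃ a : Σ w : RepetitionQuiver V, (w ⟶ x), L.label a.1.vertex = k := by
  obtain ⟨l, u⟩ := x
  obtain ⟨t, rfl⟩ := L.label.surjective k
  obtain ⟨a | a, -⟩ := L.unique_arrow hk
  · exact ⟨⟨⟨l, t⟩, .inl ⟨a, rfl⟩⟩, rfl⟩
  · exact ⟨⟨⟨l - 1, t⟩, .inr ⟨a, (sub_add_cancel l 1).symm⟩⟩, rfl⟩

theorem hom_unique {x : RepetitionQuiver V} {a b : Σ w : RepetitionQuiver V, (w ⟶ x)}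
    (h : L.label a.1.vertex = L.label b.1.vertex) : a = b := by
  have hw : a.1 = b.1 := L.toStandard.injective <| by
    rw [(L.toStandard_of_hom a.2).2, (L.toStandard_of_hom b.2).2, h]
  obtain ⟨w, a⟩ := a
  obtain ⟨w', b⟩ := b
  obtain rfl : w = w' := hw
  obtain ⟨c, hc⟩ := L.unique_arrow (L.toStandard_of_hom a).1
  congr 1
  rcases a with ⟨a, ha⟩ | ⟨a, ha⟩ <;> rcases b with ⟨b, hb⟩ | ⟨b, hb⟩
  · obtain rfl : a = b := Sum.inl_injective ((hc (.inl a)).trans (hc (.inl b)).symm)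
    rfl
  · simpa using (hc (.inl a)).trans (hc (.inr b)).symm
  · simpa using (hc (.inr a)).trans (hc (.inl b)).symm
  · obtain rfl : a = b := Sum.inr_injective ((hc (.inr a)).trans (hc (.inr b)).symm)
    rfl

/-- A function on the repetition quiver as a function on the standard one. -/
noncomputable def transport {M : Type*} (f : RepetitionQuiver V → M) (m : ℤ) (i : Fin T.rank) : M :=
  f (L.toStandard.symm (m, i))

theorem transport_toStandard {M : Type*} (f : RepetitionQuiver V → M) (x : RepetitionQuiver V) :
    L.transport f (L.toStandard x).1 (L.toStandard x).2 = f x := by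
  rw [transport, Prod.mk.eta, Equiv.symm_apply_apply]

theorem transport_injective {M : Type*} :
    Function.Injective (L.transport : (RepetitionQuiver V → M) → _) := fun f g h => by
  funext x
  rw [← L.transport_toStandard f, h, L.transport_toStandard]

theorem transport_neg_reversals {M : Type*} (f : RepetitionQuiver V → M) (i : Fin T.rank) :
    L.transport f (-L.reversals i) i = f ⟨0, L.label.symm i⟩ := by
  simp [transport, toStandard]

@[to_additive]
theorem finprod_hom_eq_meshProd {M : Type*} [CommMonoid M] (f : RepetitionQuiver V → M)
    (x : RepetitionQuiver V) :
    ∏ᶠ α : Σ w : RepetitionQuiver V, (w ⟶ x), f α.1 =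
      T.meshProd (L.transport f) (L.toStandard x).1 (L.toStandard x).2 := by
  choose β hβ using fun k : T.nbrs (L.toStandard x).2 => L.exists_hom x ((T.mem_nbrs).1 k.2)
  have hbij : Function.Bijective β := by
    refine ⟨fun k l h => Subtype.ext (by rw [← hβ k, h, hβ]), fun a => ?_⟩
    exact ⟨⟨_, (T.mem_nbrs).2 (L.toStandard_of_hom a.2).1⟩, L.hom_unique (hβ _)⟩
  have h := finprod_eq_of_bijective (f := fun k => f (β k).1)
    (g := fun α : Σ w : RepetitionQuiver V, (w ⟶ x) => f α.1) β hbij fun _ => rfl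
  have e : ∀ k, f (β k).1 = L.transport f ((L.toStandard x).1 +
      T.offset k.1 (L.toStandard x).2) k.1 := fun k => by
    rw [← L.transport_toStandard f, (L.toStandard_of_hom (β k).2).2, hβ]
    rfl
  rw [← h, finprod_eq_prod_of_fintype, Finset.prod_congr rfl fun k _ => e k]
  exact Finset.prod_coe_sort (T.nbrs (L.toStandard x).2) fun k =>
    L.transport f ((L.toStandard x).1 + T.offset k (L.toStandard x).2) k

theorem transport_tau {M : Type*} (f : RepetitionQuiver V → M) (x : RepetitionQuiver V) :
    L.transport f ((L.toStandard x).1 - 1) (L.toStandard x).2 = f (RepetitionQuiver.tau x) := by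
  rw [← L.transport_toStandard f (RepetitionQuiver.tau x)]
  simp only [toStandard, RepetitionQuiver.tau, Equiv.coe_fn_mk]
  congr 1
  ring

theorem isAdditiveFrieze_iff {R : Type*} [CommRing R] {f : RepetitionQuiver V → R} :
    RepetitionQuiver.IsAdditiveFrieze f ↔ ∀ m i, L.transport f (m - 1) i + L.transport f m i =
      T.meshSum (L.transport f) m i := by
  have key : ∀ x, f (RepetitionQuiver.tau x) + f x = ∑ᶠ α : Σ w : RepetitionQuiver V, (w ⟶ x), f α.1
      ↔ L.transport f ((L.toStandard x).1 - 1) (L.toStandard x).2 +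
        L.transport f (L.toStandard x).1 (L.toStandard x).2 =
        T.meshSum (L.transport f) (L.toStandard x).1 (L.toStandard x).2 := fun x => by
    rw [L.finsum_hom_eq_meshSum, L.transport_tau, L.transport_toStandard]
  refine ⟨fun h m i => ?_, fun h x => (key x).2 (h _ _)⟩
  have := (key _).1 (h (L.toStandard.symm (m, i)))
  rwa [Equiv.apply_symm_apply] at this

theorem isMultiplicativeFrieze_iff {K : Type*} [Field K] {f : RepetitionQuiver V → K} :
    RepetitionQuiver.IsMultiplicativeFrieze f ↔ IsFrieze (L.transport f) := by
  have key : ∀ x, f (RepetitionQuiver.tau x) * f x =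
        1 + ∏ᶠ α : Σ w : RepetitionQuiver V, (w ⟶ x), f α.1
      ↔ L.transport f ((L.toStandard x).1 - 1) (L.toStandard x).2 *
        L.transport f (L.toStandard x).1 (L.toStandard x).2 =
        1 + T.meshProd (L.transport f) (L.toStandard x).1 (L.toStandard x).2 := fun x => by
    rw [L.finprod_hom_eq_meshProd, L.transport_tau, L.transport_toStandard]
  refine ⟨fun h m i => ?_, fun h x => (key x).2 (h _ _)⟩
  have := (key _).1 (h (L.toStandard.symm (m, i)))
  rwa [Equiv.apply_symm_apply] at this

theorem exists_transport_eq {M : Type*} (F : ℤ → Fin T.rank → M) :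
    ∃ f : RepetitionQuiver V → M, L.transport f = F :=
  ⟨fun x => F (L.toStandard x).1 (L.toStandard x).2, by funext m i; simp [transport]⟩

theorem toStandard_tau_inv (x : RepetitionQuiver V) :
    L.toStandard (RepetitionQuiver.tau⁻¹ x) = ((L.toStandard x).1 + 1, (L.toStandard x).2) :=
  Prod.ext (add_sub_right_comm _ _ _) rfl

theorem toStandard_serre (x : RepetitionQuiver V) :
    L.toStandard (L.serre x) = ((L.toStandard x).1 + T.nuShift (L.toStandard x).2 + 1,
      T.nuPerm (L.toStandard x).2) := by
  rw [serre, toStandard_tau_inv, nakayama, Equiv.apply_symm_apply]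
  rfl

theorem apply_serre {M : Type*} (f : RepetitionQuiver V → M) (x : RepetitionQuiver V) :
    f (L.serre x) = twist 1 (L.transport f) (L.toStandard x).1 (L.toStandard x).2 := by
  rw [← L.transport_toStandard f, toStandard_serre]
  rfl

theorem apply_frobenius {M : Type*} (f : RepetitionQuiver V → M) (x : RepetitionQuiver V) :
    f (L.frobenius x) = twist 2 (L.transport f) (L.toStandard x).1 (L.toStandard x).2 := by
  rw [← L.transport_toStandard f, frobenius, toStandard_tau_inv, toStandard_serre, twist]
  simp only [add_assoc, one_add_one_eq_two]

theorem apply_tau_inv_pow {M : Type*} (f : RepetitionQuiver V → M) (x : RepetitionQuiver V)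
    (d : ℕ) : f ((RepetitionQuiver.tau⁻¹ ^ d) x) =
      L.transport f ((L.toStandard x).1 + d) (L.toStandard x).2 := by
  have h : L.toStandard ((RepetitionQuiver.tau⁻¹ ^ d) x) =
      ((L.toStandard x).1 + d, (L.toStandard x).2) := by
    induction d with
    | zero => simp
    | succ d ih =>
      rw [pow_succ', Equiv.Perm.mul_apply, toStandard_tau_inv, ih]
      simp only [Nat.cast_succ, add_assoc]
  rw [← L.transport_toStandard f, h]

end DynkinLabelling

namespace DynkinType

variable {T : DynkinType}

theorem twist_one_eq_neg {R : Type*} [CommRing R] {f : ℤ → Fin T.rank → R}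
    (hf : ∀ m i, f (m - 1) i + f m i = T.meshSum f m i) (m : ℤ) (i : Fin T.rank) :
    twist 1 f m i = -f m i := by
  obtain ⟨H, hH⟩ := T.exists_isHammock i
  have := hH.add_eq_zero (f := fun l k => f (l + m) k) fun l k => by
    rw [meshSum_shift, ← hf]
    congr 2
    ring
  rw [zero_add, add_comm] at this
  rw [← eq_neg_of_add_eq_zero_left this, twist]
  congr 1
  ring

theorem twist_twist {M : Type*} (c : ℤ) (f : ℤ → Fin T.rank → M) (m : ℤ) (i : Fin T.rank) :
    twist c (twist c f) m i = f (m + (T.coxeterNumber - 2 + 2 * c)) i := by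
  rw [twist, twist, T.nuPerm_nuPerm, ← T.nuShift_add_nuShift i]
  congr 1
  ring

end DynkinType

theorem DynkinLabelling.existsUnique_additive {T : DynkinType} {V : Type u} [Quiver.{v} V]
    (L : DynkinLabelling T V) : ∃! f : RepetitionQuiver V → MvPolynomial V ℤ,
      RepetitionQuiver.IsGenericAdditiveFrieze f := by
  have hs := L.isSlice_neg_reversals
  have knit : ∀ {F : ℤ → Fin T.rank → MvPolynomial V ℤ},
      (∀ m i, F (m - 1) i + F m i = T.meshSum F m i) →
      DynkinType.IsAddKnit (fun h a => h - a) (fun i => -L.reversals i) F := fun h =>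
    ⟨fun m i _ => eq_sub_of_add_eq' (h m i), fun m i _ => eq_sub_of_add_eq (h m i)⟩
  obtain ⟨F, hF, hF0⟩ := DynkinType.exists_isAddKnit (fun h a : MvPolynomial V ℤ => h - a) hs
    fun i => MvPolynomial.X (L.label.symm i)
  obtain ⟨f, rfl⟩ := L.exists_transport_eq F
  refine ⟨f, ⟨L.isAdditiveFrieze_iff.2 fun m i => ?_, fun u => ?_⟩, fun g hg => ?_⟩
  · rcases lt_or_ge (-L.reversals i) m with h | h
    · rw [hF.1 m i h]; ring
    · rw [hF.2 m i h]; ring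
  · simpa [L.transport_neg_reversals] using hF0 (L.label u)
  · refine L.transport_injective ((knit (L.isAdditiveFrieze_iff.1 hg.1)).unique hs hF fun i => ?_)
    rw [hF0, L.transport_neg_reversals, hg.2]

theorem DynkinLabelling.generic_ne_zero {T : DynkinType} {V : Type u} [Quiver.{v} V]
    (L : DynkinLabelling T V) {g : RepetitionQuiver V → FractionRing (MvPolynomial V ℚ)}
    (hg : RepetitionQuiver.IsGenericMultiplicativeFrieze g) (m : ℤ) (i : Fin T.rank) :
    L.transport g m i ≠ 0 :=
  (L.isMultiplicativeFrieze_iff.1 hg.1).ne_zero (ev := DynkinType.evalOne V ℚ)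
    L.isSlice_neg_reversals (fun i => by
      rw [L.transport_neg_reversals, hg.2]
      exact .of_pos (DynkinType.evalOne_X_pos _)) m i

theorem DynkinLabelling.existsUnique_multiplicative {T : DynkinType} {V : Type u} [Quiver.{v} V]
    (L : DynkinLabelling T V) : ∃! g : RepetitionQuiver V → FractionRing (MvPolynomial V ℚ),
      RepetitionQuiver.IsGenericMultiplicativeFrieze g := by
  have hs := L.isSlice_neg_reversals
  obtain ⟨G, hG, hG0⟩ := DynkinType.exists_isFrieze (K := FractionRing (MvPolynomial V ℚ))
    (ev := DynkinType.evalOne V ℚ) hs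
    (x := fun i => algebraMap (MvPolynomial V ℚ) _ (MvPolynomial.X (L.label.symm i)))
    fun i => .of_pos (DynkinType.evalOne_X_pos _)
  obtain ⟨f, rfl⟩ := L.exists_transport_eq G
  have hf : RepetitionQuiver.IsGenericMultiplicativeFrieze f :=
    ⟨L.isMultiplicativeFrieze_iff.2 hG, fun u => by
      simpa [L.transport_neg_reversals] using hG0 (L.label u)⟩
  refine ⟨f, hf, fun g hg => L.transport_injective ?_⟩
  refine (L.isMultiplicativeFrieze_iff.1 hg.1).unique hs (L.generic_ne_zero hg) hG
    (L.generic_ne_zero hf) fun i => ?_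
  rw [hG0, L.transport_neg_reversals, hg.2]

theorem mainTheorem2 (T : DynkinType) {V : Type u} [Quiver.{v} V] (L : DynkinLabelling T V) :
    (∃! f : RepetitionQuiver V → MvPolynomial V ℤ,
        RepetitionQuiver.IsGenericAdditiveFrieze f) ∧
    (∃! g : RepetitionQuiver V → FractionRing (MvPolynomial V ℚ),
        RepetitionQuiver.IsGenericMultiplicativeFrieze g) ∧
    (∀ f : RepetitionQuiver V → MvPolynomial V ℤ,
        RepetitionQuiver.IsGenericAdditiveFrieze f →
          f ∘ L.serre = -f ∧
          f ∘ (RepetitionQuiver.tau⁻¹ ^ T.coxeterNumber) = f) ∧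
    (∀ g : RepetitionQuiver V → FractionRing (MvPolynomial V ℚ),
        RepetitionQuiver.IsGenericMultiplicativeFrieze g →
          g ∘ L.frobenius = g ∧
          g ∘ (RepetitionQuiver.tau⁻¹ ^ (T.coxeterNumber + 2)) = g) := by
  refine ⟨L.existsUnique_additive, L.existsUnique_multiplicative, fun f hf => ?_, fun g hg => ?_⟩
  · have h := DynkinType.twist_one_eq_neg (L.isAdditiveFrieze_iff.1 hf.1)
    refine ⟨funext fun x => ?_, funext fun x => ?_⟩
    · rw [Function.comp_apply, L.apply_serre f, h, L.transport_toStandard, Pi.neg_apply]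
    · have h2 := DynkinType.twist_twist 1 (L.transport f) (L.toStandard x).1 (L.toStandard x).2
      have h3 := (h _ _).trans (neg_eq_iff_eq_neg.2 (h (L.toStandard x).1 (L.toStandard x).2))
      rw [Function.comp_apply, L.apply_tau_inv_pow f, ← L.transport_toStandard f x, ← h3]
      refine Eq.trans ?_ h2.symm
      congr 1
      ring
  · have h := (L.isMultiplicativeFrieze_iff.1 hg.1).twist_eq (L.generic_ne_zero hg)
    refine ⟨funext fun x => ?_, funext fun x => ?_⟩
    · rw [Function.comp_apply, L.apply_frobenius g, h, L.transport_toStandard]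
    · have h2 := DynkinType.twist_twist 2 (L.transport g) (L.toStandard x).1 (L.toStandard x).2
      rw [h, h, L.transport_toStandard] at h2
      rw [Function.comp_apply, L.apply_tau_inv_pow g, h2]
      congr 1
      push_cast
      ring
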